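/- Let $K$ be a non-archimedean local field with absolute value $|\cdot|$, let $B_r(a)=\{y:|y-a|\le r\}$, let $\mathcal O=B_1(0)$, and let $\mu$ be the Haar measure on $K$ with $\mu(\mathcal O)=1$. Let $X\subseteq K$ be compact and open, and let $T:X\to X$ be \emph{locally scaling} for $r\in|K^\times|$ with scaling function $C:X\to\mathbb R_{\ge1}$. This means that $X$ is a finite union of balls of radius $r$, and $|T(x)-T(y)|=C(x)|x-y|$ for all $x,y\in X$ with $|x-y|\le r$. Assume that $T$ preserves $\mu|_X$. Let $H=X/B_r(0)$ be the set of $r$-balls contained in $X$. The function $C$ is constant on each $i\in H$, with value denoted $C(i)$. The associated transition matrix $A:H\times H\to\mathbb R_{\ge0}$ is defined by $A(i,j)=0$ if $i\cap T^{-1}(j)=\emptyset$, and $A(i,j)=\mu(B_{1/C(i)}(0))$ otherwise. For a matrix $A'$ on a finite set $H'$ and a non-negative row vector $\mathbf v$ on $H'$, let $X_{A'}=\{(x_n)_{n\ge0}\in H'^{\mathbb N}: A'(x_n,x_{n+1})\neq0\ \forall n\}$ with the subspace topology of the product of discrete spaces, and let $T_{A'}$ be the left shift on $X_{A'}$. For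 $A'$ stochastic, let $\mu_{A',\mathbf v}$ be the Borel measure on $X_{A'}$ with $\mu_{A',\mathbf v}([d_0\ldots d_\ell])=\mathbf v(d_0)A'(d_0,d_1)\cdots A'(d_{\ell-1},d_\ell)$ for all cylinder sets; the system $(X_{A'},\mu_{A',\mathbf v},T_{A'})$ is called a Markov shift. A system is \emph{Markov} if it is isomorphic to a Markov shift. An isomorphism is a homeomorphism that preserves the measures in both directions and intertwines the maps. A self-map is \emph{locally an isometry} if every point has a neighbourhood on which the map preserves distances. Let $\mathbf v$ be the row vector with constant value $\mu(B_r(0))$, let $\Sigma=(X,\mu|_X,T)$ and $\Sigma'=(X_A,\mu_{A,\mathbf v},T_A)$, and let $\Phi:X\to X_A$ be the map whose $n$-th coordinate at $x$ is the $r$-ball containing $T^n(x)$. Then $\Sigma'$ is measure-preserving, and $H$ can be partitioned as $H=\bigsqcup_{k=1}^nH_k$ into non-empty sets such that $A(i,j)=0$ for $i\in H_k$, $j\in H_\ell$, $k\ne\ell$, and each $A_k=A|_{H_k\times H_k}$ is irreducible. For every such partition the following hold, where $\Sigma'_k=(X_{A_k},\mu_{A_k,\mathbf v|_{H_k}},T_{A_k})$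 and $X_{A_k}$ is also regarded as the set of sequences in $X_A$ with all entries in $H_k$: 1. $\Sigma'\cong\bigsqcup_k\Sigma'_k$. 2. The sets $C_k=\Phi^{-1}(X_{A_k})$ form a partition of $X$ into clopen sets with $T^{-1}(C_k)=C_k$. 3. Let $\widetilde\Sigma_k$ be the restriction of $\Sigma$ to $C_k$ if $X_{A_k}$ is finite, and $\Sigma'_k$ if $X_{A_k}$ is infinite. Then $$\Sigma\cong\bigsqcup_{k=1}^n\widetilde\Sigma_k$$ as topological and measurable dynamical systems, and for each $k$ the restriction of $\Sigma$ to $C_k$ is isomorphic to $\widetilde\Sigma_k$. 4. If $X_{A_k}$ is finite, then $T|_{C_k}$ is locally an isometry. If $X_{A_k}$ is infinite, then $\widetilde\Sigma_k$ is Markov and ergodic. -/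

import Mathlib

open Set MeasureTheory Topology

universe u

/-! ### Dynamical systems carrying a topology and a measure -/

/-- A space with a topology, a σ-algebra, a measure and a self-map. -/
structure DynSystem : Type (u + 1) where
  carrier : Type u
  top : TopologicalSpace carrier
  meas : MeasurableSpace carrier
  measure : Measure carrier
  map : carrier → carrier

namespace DynSystem

instance (S : DynSystem.{u}) : TopologicalSpace S.carrier := S.top

instance (S : DynSystem.{u}) : MeasurableSpace S.carrier := S.meas

/-- Isomorphism of topological and measurable dynamical systems: a homeomorphism which is
measure-preserving in both directions and intertwines the two self-maps. -/
def Iso (S R : DynSystem.{u}) : Prop :=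
  ∃ e : S.carrier ≃ₜ R.carrier,
    MeasurePreserving e S.measure R.measure ∧
    MeasurePreserving e.symm R.measure S.measure ∧
    ∀ x, e (S.map x) = R.map (e x)

/-- The restriction of a system to a forward-invariant subset. -/
noncomputable def restrict (S : DynSystem.{u}) (Y : Set S.carrier) (hY : MapsTo S.map Y Y) :
    DynSystem.{u} where
  carrier := Y
  top := inferInstance
  meas := inferInstance
  measure := S.measure.comap Subtype.val
  map := hY.restrict S.map Y Y

/-- The disjoint union of a finite family of systems. -/
noncomputable def disjointUnion {n : ℕ} (S : Fin n → DynSystem.{u}) : DynSystem.{u} where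
  carrier := Σ k, (S k).carrier
  top := inferInstance
  meas := inferInstance
  measure := Measure.sum fun k => (S k).measure.map (Sigma.mk k)
  map := fun x => ⟨x.1, (S x.1).map x.2⟩

end DynSystem

/-- A self-map of a metric space is locally an isometry if every point has a neighbourhood on
which the map preserves distances. -/
def IsLocallyIsometric {M : Type*} [PseudoMetricSpace M] (f : M → M) : Prop :=
  ∀ x, ∃ U ∈ 𝓝 x, ∀ y ∈ U, ∀ z ∈ U, dist (f y) (f z) = dist y z

/-! ### Markov shifts -/

/-- Non-negative entries, every row sums to `1`. -/
structure IsStochastic {H : Type*} [Fintype H] (A : Matrix H H ℝ) : Prop where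
  nonneg : ∀ i j, 0 ≤ A i j
  row_sum : ∀ i, ∑ j, A i j = 1

/-- The space of sequences all of whose transitions are allowed by `A`. -/
def ShiftSpace {H : Type u} (A : Matrix H H ℝ) : Type u :=
  {x : ℕ → H // ∀ n, A (x n) (x (n + 1)) ≠ 0}

namespace ShiftSpace

variable {H : Type u} (A : Matrix H H ℝ)

variable {A} in
/-- The underlying sequence. -/
def seq (x : ShiftSpace A) : ℕ → H := x.1

/-- The subspace topology of the product topology, each factor being discrete. -/
instance : TopologicalSpace (ShiftSpace A) :=
  TopologicalSpace.induced seq (Pi.topologicalSpace (t₂ := fun _ => ⊥))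

instance : MeasurableSpace (ShiftSpace A) := borel _

/-- The left shift. -/
def shift (x : ShiftSpace A) : ShiftSpace A :=
  ⟨fun n => x.1 (n + 1), fun n => x.2 (n + 1)⟩

/-- The cylinder set `[d₀ d₁ … d_ℓ]`. -/
def cyl {ℓ : ℕ} (d : Fin (ℓ + 1) → H) : Set (ShiftSpace A) :=
  {x | ∀ n : Fin (ℓ + 1), x.seq n = d n}

end ShiftSpace

/-- `ν [d₀ … d_ℓ] = v(d₀) A(d₀, d₁) ⋯ A(d_{ℓ-1}, d_ℓ)` for all cylinder sets. -/
def IsMarkovMeasure {H : Type u} (A : Matrix H H ℝ) (v : H → ℝ)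
    (ν : Measure (ShiftSpace A)) : Prop :=
  ∀ (ℓ : ℕ) (d : Fin (ℓ + 1) → H),
    ν (ShiftSpace.cyl A d) =
      ENNReal.ofReal (v (d 0) * ∏ n : Fin ℓ, A (d n.castSucc) (d n.succ))

open Classical in
/-- The Markov measure on `ShiftSpace A` with initial row vector `v`, determined by its values
on cylinder sets. -/
noncomputable def markovMeasure {H : Type u} (A : Matrix H H ℝ) (v : H → ℝ) :
    Measure (ShiftSpace A) :=
  if h : ∃ ν, IsMarkovMeasure A v ν then h.choose else 0

/-- The Markov shift attached to `A` and `v`. -/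
noncomputable def markovShift {H : Type u} (A : Matrix H H ℝ) (v : H → ℝ) : DynSystem.{u} where
  carrier := ShiftSpace A
  top := inferInstance
  meas := inferInstance
  measure := markovMeasure A v
  map := ShiftSpace.shift A

/-- A system is Markov if it is isomorphic to some Markov shift. -/
def DynSystem.IsMarkov (S : DynSystem.{u}) : Prop :=
  ∃ (H : Type u) (_ : Fintype H) (_ : Nonempty H) (A : Matrix H H ℝ) (v : H → ℝ),
    IsStochastic A ∧ (∀ i, 0 ≤ v i) ∧ S.Iso (markovShift A v)

/-- The block `A|_{P × P}`. -/
def Matrix.block {H : Type u} (A : Matrix H H ℝ) (P : Set H) : Matrix P P ℝ :=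
  A.submatrix Subtype.val Subtype.val

/-- A partition of the index set into non-empty classes with no transitions between distinct
classes, and such that each diagonal block is irreducible. -/
structure IsIrreducibleDecomposition {H : Type u} (A : Matrix H H ℝ) {n : ℕ}
    (P : Fin n → Set H) : Prop where
  nonempty : ∀ k, (P k).Nonempty
  disjoint : Pairwise fun k l => Disjoint (P k) (P l)
  cover : ⋃ k, P k = univ
  off_diagonal : ∀ k l, k ≠ l → ∀ i ∈ P k, ∀ j ∈ P l, A i j = 0
  irreducible : ∀ k, (A.block (P k)).IsIrreducible

/-! ### Existence and uniqueness of Markov measures -/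

namespace MarkovExistence

variable {H : Type u}

/-- The path started at `h` driven by the array `ω` of successors. -/
def path (h : H) (ω : ℕ × H → H) : ℕ → H
  | 0 => h
  | n + 1 => ω (n, path h ω n)

theorem measurable_path [Finite H] [MeasurableSpace H] [DiscreteMeasurableSpace H] (h : H) :
    Measurable (path h) := by
  refine measurable_pi_lambda _ fun n => ?_
  induction n with
  | zero => exact measurable_const
  | succ n ih =>
    refine measurable_to_countable' fun j => ?_
    have : (fun ω : ℕ × H → H => path h ω (n + 1)) ⁻¹' {j} =
        ⋃ i, ((fun ω => path h ω n) ⁻¹' {i}) ∩ {ω | ω (n, i) = j} := by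
      ext ω
      simp [path]
    rw [this]
    refine MeasurableSet.iUnion fun i => (ih (measurableSet_singleton i)).inter ?_
    have hev : Measurable fun ω : ℕ × H → H => ω (n, i) := measurable_pi_apply (n, i)
    exact hev (measurableSet_singleton j)

theorem path_cyl {ℓ : ℕ} (d : Fin (ℓ + 1) → H) (ω : ℕ × H → H) :
    (∀ n : Fin (ℓ + 1), path (d 0) ω n = d n) ↔
      ∀ n : Fin ℓ, ω (n, d n.castSucc) = d n.succ := by
  constructor
  · intro hd n
    have h1 := hd n.castSucc
    have h2 := hd n.succ
    rw [Fin.val_castSucc] at h1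
    rw [Fin.val_succ, path, h1] at h2
    exact h2
  · intro hω n
    induction n using Fin.induction with
    | zero => rfl
    | succ n ih =>
      rw [Fin.val_castSucc] at ih
      rw [Fin.val_succ, path, ih, hω]

open Classical in
theorem pi_image_iff {ℓ : ℕ} (d : Fin (ℓ + 1) → H) :
    {ω : ℕ × H → H | ∀ n : Fin ℓ, ω (n, d n.castSucc) = d n.succ} =
      Set.pi ((Finset.univ.image fun n : Fin ℓ => ((n : ℕ), d n.castSucc)) : Finset (ℕ × H))
        fun p => {j | ∀ n : Fin ℓ, (n : ℕ) = p.1 → j = d n.succ} := by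
  ext ω
  simp only [Set.mem_ofPred_eq, Set.mem_pi, Finset.coe_image, Finset.coe_univ, Set.image_univ,
    Set.mem_range]
  constructor
  · rintro hω _ ⟨n, rfl⟩ m hm
    obtain rfl : m = n := Fin.ext hm
    exact hω m
  · intro hω n
    exact hω _ ⟨n, rfl⟩ n rfl

theorem measurableEmbedding_seq [Finite H] [MeasurableSpace H] [DiscreteMeasurableSpace H]
    (A : Matrix H H ℝ) :
    MeasurableEmbedding (ShiftSpace.seq : ShiftSpace A → ℕ → H) := by
  let : TopologicalSpace H := ⊥
  have : DiscreteTopology H := ⟨rfl⟩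
  have hcl : IsClosed {x : ℕ → H | ∀ n, A (x n) (x (n + 1)) ≠ 0} := by
    rw [Set.ofPred_forall]
    refine isClosed_iInter fun n => ?_
    have hc : Continuous fun x : ℕ → H => (x n, x (n + 1)) :=
      (continuous_apply n).prodMk (continuous_apply (n + 1))
    exact (isClosed_discrete {p : H × H | A p.1 p.2 ≠ 0}).preimage hc
  have : BorelSpace (ShiftSpace A) := ⟨rfl⟩
  have he : IsClosedEmbedding (ShiftSpace.seq : ShiftSpace A → ℕ → H) := by
    refine ⟨⟨⟨rfl⟩, fun x y h => Subtype.ext h⟩, ?_⟩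
    convert hcl
    ext x
    exact ⟨fun ⟨y, hy⟩ => hy ▸ y.2, fun hx => ⟨⟨x, hx⟩, rfl⟩⟩
  exact he.measurableEmbedding

end MarkovExistence

open Classical MarkovExistence in
/-- For a stochastic matrix and a non-negative row vector the Markov measure exists. -/
theorem exists_isMarkovMeasure {H : Type u} [Fintype H] {A : Matrix H H ℝ} {v : H → ℝ}
    (hA : IsStochastic A) (hv : ∀ i, 0 ≤ v i) : ∃ ν, IsMarkovMeasure A v ν := by
  let : MeasurableSpace H := ⊤
  let row : H → Measure H := fun i => ∑ j, ENNReal.ofReal (A i j) • Measure.dirac j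
  have hrow : ∀ i j, row i {j} = ENNReal.ofReal (A i j) := by
    intro i j
    simp [row, Set.indicator_apply]
  have : ∀ p : ℕ × H, IsProbabilityMeasure (row p.2) := fun p => ⟨by
    simp only [row, Measure.coe_finsetSum, Measure.coe_smul, Finset.sum_apply, Pi.smul_apply,
      measure_univ, smul_eq_mul, mul_one]
    rw [← ENNReal.ofReal_sum_of_nonneg fun j _ => hA.nonneg _ j, hA.row_sum, ENNReal.ofReal_one]⟩
  let Q : Measure (ℕ × H → H) := Measure.infinitePi fun p : ℕ × H => row p.2
  let ν₀ : Measure (ℕ → H) := ∑ i, ENNReal.ofReal (v i) • Q.map (path i)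
  have hQ : ∀ (ℓ : ℕ) (d : Fin (ℓ + 1) → H),
      Q {ω | ∀ n : Fin ℓ, ω (n, d n.castSucc) = d n.succ} =
        ∏ n : Fin ℓ, ENNReal.ofReal (A (d n.castSucc) (d n.succ)) := by
    intro ℓ d
    rw [pi_image_iff, Measure.infinitePi_pi _ (fun _ _ => MeasurableSet.of_discrete),
      Finset.prod_image]
    · refine Finset.prod_congr rfl fun n _ => ?_
      rw [← hrow]
      congr 1
      ext j
      constructor
      · intro hj
        exact hj n rfl
      · rintro hj m hm
        obtain rfl : m = n := Fin.ext hm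
        exact hj
    · intro m _ n _ hmn
      exact Fin.ext (Prod.ext_iff.1 hmn).1
  have hcyl : ∀ (ℓ : ℕ) (d : Fin (ℓ + 1) → H),
      ν₀ {x | ∀ n : Fin (ℓ + 1), x n = d n} =
        ENNReal.ofReal (v (d 0) * ∏ n : Fin ℓ, A (d n.castSucc) (d n.succ)) := by
    intro ℓ d
    have hm : MeasurableSet {x : ℕ → H | ∀ n : Fin (ℓ + 1), x n = d n} := by
      rw [Set.ofPred_forall]
      exact MeasurableSet.iInter fun n => measurable_pi_apply (n : ℕ) (measurableSet_singleton _)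
    have h0 : ∀ i, (Q.map (path i)) {x | ∀ n : Fin (ℓ + 1), x n = d n} =
        if i = d 0 then ∏ n : Fin ℓ, ENNReal.ofReal (A (d n.castSucc) (d n.succ)) else 0 := by
      intro i
      rw [Measure.map_apply (measurable_path i) hm]
      split_ifs with hi
      · subst hi
        rw [← hQ]
        congr 1
        ext ω
        exact path_cyl d ω
      · convert measure_empty (μ := Q)
        ext ω
        simp only [Set.mem_preimage, Set.mem_ofPred_eq, Set.mem_empty_iff_false, iff_false]
        intro hω
        exact hi (hω 0)
    simp only [ν₀, Measure.coe_finsetSum, Measure.coe_smul, Finset.sum_apply, Pi.smul_apply,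
      smul_eq_mul, h0, mul_ite, mul_zero, Finset.sum_ite_eq', Finset.mem_univ, if_true]
    rw [ENNReal.ofReal_mul (hv _), ENNReal.ofReal_prod_of_nonneg fun n _ => hA.nonneg _ _]
  have hnull : ν₀ {x | ∀ n, A (x n) (x (n + 1)) ≠ 0}ᶜ = 0 := by
    have hsub : {x : ℕ → H | ∀ n, A (x n) (x (n + 1)) ≠ 0}ᶜ ⊆
        ⋃ p : (Σ n : ℕ, {d : Fin (n + 2) → H // A (d (Fin.last n).castSucc) (d (Fin.last _)) = 0}),
          {x | ∀ m : Fin (p.1 + 2), x m = p.2.1 m} := by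
      intro x hx
      simp only [Set.mem_compl_iff, Set.mem_ofPred_eq, not_forall, not_not] at hx
      obtain ⟨n, hn⟩ := hx
      exact Set.mem_iUnion.2 ⟨⟨n, fun m => x m, by simpa using hn⟩, fun m => rfl⟩
    refine measure_mono_null hsub (measure_iUnion_null ?_)
    rintro ⟨n, d, hd⟩
    rw [hcyl (n + 1) d, Finset.prod_eq_zero (Finset.mem_univ (Fin.last n)), mul_zero,
      ENNReal.ofReal_zero]
    simpa using hd
  refine ⟨ν₀.comap (ShiftSpace.seq : ShiftSpace A → ℕ → H), fun ℓ d => ?_⟩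
  refine ((measurableEmbedding_seq A).comap_apply ν₀ _).trans ?_
  rw [← hcyl]
  have himg : (ShiftSpace.seq '' ShiftSpace.cyl A d : Set (ℕ → H)) =
      {x | ∀ n : Fin (ℓ + 1), x n = d n} ∩ {x | ∀ n, A (x n) (x (n + 1)) ≠ 0} := by
    ext x
    constructor
    · rintro ⟨y, hy, rfl⟩
      exact ⟨hy, y.2⟩
    · rintro ⟨h1, h2⟩
      exact ⟨⟨x, h2⟩, h1, rfl⟩
  rw [himg]
  exact measure_inter_conull hnull

/-- The values of the Markov measure on cylinder sets. -/
theorem isMarkovMeasure_markovMeasure {H : Type u} [Fintype H] {A : Matrix H H ℝ} {v : H → ℝ}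
    (hA : IsStochastic A) (hv : ∀ i, 0 ≤ v i) : IsMarkovMeasure A v (markovMeasure A v) := by
  have h := exists_isMarkovMeasure hA hv
  rw [markovMeasure, dif_pos h]
  exact h.choose_spec

open MarkovExistence in
theorem borel_eq_generateFrom_cyl {H : Type u} [Finite H] (A : Matrix H H ℝ) :
    ShiftSpace.instMeasurableSpace A = MeasurableSpace.generateFrom
      {s | ∃ (ℓ : ℕ) (d : Fin (ℓ + 1) → H), s = ShiftSpace.cyl A d} := by
  let _ : MeasurableSpace H := ⊤
  have hcyl : ∀ (ℓ : ℕ) (d : Fin (ℓ + 1) → H), MeasurableSet (ShiftSpace.cyl A d) := by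
    intro ℓ d
    rw [ShiftSpace.cyl, Set.ofPred_forall]
    refine MeasurableSet.iInter fun n => ?_
    exact ((measurable_pi_apply (n : ℕ)).comp (measurableEmbedding_seq A).measurable)
      (measurableSet_singleton (d n))
  refine le_antisymm ?_ (MeasurableSpace.generateFrom_le ?_)
  · rw [← (measurableEmbedding_seq A).comap_eq, ← measurable_iff_comap_le]
    refine @measurable_pi_lambda _ _ _ (_) _ _ fun n => ?_
    refine @measurable_to_countable' _ _ _ _ (_) _ fun j => ?_
    have : (fun x : ShiftSpace A => x.seq n) ⁻¹' {j} =
        ⋃ d : {d : Fin (n + 1) → H // d (Fin.last n) = j}, ShiftSpace.cyl A d.1 := by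
      ext x
      simp only [Set.mem_preimage, Set.mem_singleton_iff, Set.mem_iUnion]
      constructor
      · intro hx
        exact ⟨⟨fun m => x.seq m, by simpa using hx⟩, fun m => rfl⟩
      · rintro ⟨⟨d, hd⟩, hx⟩
        simpa [hd] using hx (Fin.last n)
    rw [this]
    exact MeasurableSet.iUnion fun d => MeasurableSpace.measurableSet_generateFrom ⟨n, d.1, rfl⟩
  · rintro _ ⟨ℓ, d, rfl⟩
    exact hcyl ℓ d

/-- A measure on the shift space is determined by its values on cylinder sets. -/
theorem IsMarkovMeasure.unique {H : Type u} [Fintype H] {A : Matrix H H ℝ} {v : H → ℝ}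
    {ν ν' : Measure (ShiftSpace A)} (h : IsMarkovMeasure A v ν) (h' : IsMarkovMeasure A v ν') :
    ν = ν' := by
  have huniv : (⋃ i : H, ShiftSpace.cyl A (fun _ : Fin 1 => i)) = univ := by
    refine Set.eq_univ_of_forall fun x => Set.mem_iUnion.2 ⟨x.seq 0, fun n => ?_⟩
    obtain rfl : n = 0 := Fin.fin_one_eq_zero n
    rfl
  have hmeas : ∀ (ℓ : ℕ) (d : Fin (ℓ + 1) → H), MeasurableSet (ShiftSpace.cyl A d) := by
    intro ℓ d
    rw [borel_eq_generateFrom_cyl A]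
    exact MeasurableSpace.measurableSet_generateFrom ⟨ℓ, d, rfl⟩
  have hdisj : Pairwise fun i j : H => Disjoint (ShiftSpace.cyl A (fun _ : Fin 1 => i))
      (ShiftSpace.cyl A (fun _ : Fin 1 => j)) := by
    intro i j hij
    refine Set.disjoint_left.2 fun x hi hj => hij ?_
    exact (hi 0).symm.trans (hj 0)
  have hfin : IsFiniteMeasure ν := ⟨by
    rw [← huniv, measure_iUnion hdisj fun i => hmeas 0 _, tsum_fintype]
    exact ENNReal.sum_lt_top.2 fun i _ => by rw [h]; exact ENNReal.ofReal_lt_top⟩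
  refine ext_of_generate_finite _ (borel_eq_generateFrom_cyl A) ?_ ?_ ?_
  · have key : ∀ (ℓ ℓ' : ℕ) (d : Fin (ℓ + 1) → H) (d' : Fin (ℓ' + 1) → H), ℓ ≤ ℓ' →
        (ShiftSpace.cyl A d ∩ ShiftSpace.cyl A d').Nonempty →
        ShiftSpace.cyl A d ∩ ShiftSpace.cyl A d' = ShiftSpace.cyl A d' := by
      rintro ℓ ℓ' d d' hle ⟨x, hx, hx'⟩
      refine Set.inter_eq_right.2 fun y hy n => ?_
      have hn : (n : ℕ) < ℓ' + 1 := by omega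
      rw [← hx n]
      exact (hy ⟨n, hn⟩).trans (hx' ⟨n, hn⟩).symm
    rintro _ ⟨ℓ, d, rfl⟩ _ ⟨ℓ', d', rfl⟩ hne
    rcases le_total ℓ ℓ' with hle | hle
    · exact ⟨ℓ', d', key ℓ ℓ' d d' hle hne⟩
    · rw [Set.inter_comm] at hne ⊢
      exact ⟨ℓ, d, key ℓ' ℓ d' d hle hne⟩
  · rintro _ ⟨ℓ, d, rfl⟩
    rw [h, h']
  · rw [← huniv, measure_iUnion hdisj fun i => hmeas 0 _,
      measure_iUnion hdisj fun i => hmeas 0 _]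
    exact tsum_congr fun i => by rw [h, h']

/-! ### Locally scaling maps -/

section LocallyScaling

variable {K : Type u} [NontriviallyNormedField K]

/-- `T : X → X` is locally scaling for the radius `r`, with scaling function `C`. -/
structure IsLocallyScaling (X : Set K) (r : ℝ) (T : X → X) (C : X → ℝ) : Prop where
  radius_mem : ∃ c : K, c ≠ 0 ∧ ‖c‖ = r
  union_balls : ∃ F : Finset K, X = ⋃ a ∈ F, Metric.closedBall a r
  one_le : ∀ x, 1 ≤ C x
  scaling : ∀ x y : X, ‖(x : K) - y‖ ≤ r → ‖(T x : K) - T y‖ = C x * ‖(x : K) - y‖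

/-- The set `X / B_r(0)` of `r`-balls centred in `X`, as a set of subsets of `X`. -/
abbrev BallClass (X : Set K) (r : ℝ) : Type u :=
  ↥(Set.range fun a : X => {y : X | ‖(y : K) - a‖ ≤ r})

/-- The `r`-ball containing a point. -/
def toBall (X : Set K) (r : ℝ) (x : X) : BallClass X r :=
  ⟨{y : X | ‖(y : K) - x‖ ≤ r}, x, rfl⟩

/-- A point of an `r`-ball. -/
noncomputable def BallClass.rep {X : Set K} {r : ℝ} (i : BallClass X r) : X := i.2.choose

namespace IsLocallyScaling

variable {X : Set K} {r : ℝ} {T : X → X} {C : X → ℝ}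

theorem radius_pos (h : IsLocallyScaling X r T C) : 0 < r := by
  obtain ⟨c, hc, rfl⟩ := h.radius_mem
  exact norm_pos_iff.2 hc

theorem mem_toBall (h : IsLocallyScaling X r T C) (x : X) : x ∈ (toBall X r x).1 := by
  simpa [toBall] using h.radius_pos.le

/-- The scaling function is constant on each `r`-ball. -/
theorem scaling_rep (h : IsLocallyScaling X r T C) (i : BallClass X r) (x : X) (hx : x ∈ i.1) :
    C i.rep = C x := by
  have hi : {y : X | ‖(y : K) - i.rep‖ ≤ r} = i.1 := i.2.choose_spec
  rw [← hi] at hx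
  have hx' : ‖(x : K) - i.rep‖ ≤ r := hx
  by_cases hxi : x = i.rep
  · rw [← hxi]
  have hne : ‖(x : K) - i.rep‖ ≠ 0 := by
    rw [norm_ne_zero_iff, sub_ne_zero]
    exact fun e => hxi (Subtype.ext e)
  have h1 := h.scaling x i.rep hx'
  have h2 := h.scaling i.rep x (by rwa [norm_sub_rev])
  rw [norm_sub_rev, norm_sub_rev (i.rep : K)] at h2
  exact mul_right_cancel₀ hne (h2.symm.trans h1)

end IsLocallyScaling

variable [MeasurableSpace K] (μ : Measure K)

open Classical in
/-- The associated transition matrix: `A(i, j) = 0` if `i ∩ T⁻¹ j = ∅`, and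
`A(i, j) = μ (B_{1 / C(i)}(0))` otherwise. -/
noncomputable def transitionMatrix {X : Set K} (r : ℝ) (T : X → X) (C : X → ℝ) :
    Matrix (BallClass X r) (BallClass X r) ℝ :=
  fun i j => if i.1 ∩ T ⁻¹' j.1 = ∅ then 0 else μ.real (Metric.closedBall 0 (1 / C i.rep))

/-- The row vector with all entries equal to `μ (B_r(0))`. -/
noncomputable def ballVector {H : Type*} (r : ℝ) : H → ℝ :=
  fun _ => μ.real (Metric.closedBall (0 : K) r)

/-- The system `(X, μ|_X, T)`. -/
noncomputable def spaceSystem {X : Set K} (T : X → X) : DynSystem.{u} where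
  carrier := X
  top := inferInstance
  meas := inferInstance
  measure := μ.comap Subtype.val
  map := T

namespace IsLocallyScaling

variable {X : Set K} {r : ℝ} {T : X → X} {C : X → ℝ}

variable [BorelSpace K] [LocallyCompactSpace K] [μ.IsAddHaarMeasure]

/-- The coding map `Φ : X → X_A`, whose `n`-th coordinate is the `r`-ball containing `Tⁿ x`. -/
noncomputable def coding (h : IsLocallyScaling X r T C) (x : X) :
    ShiftSpace (transitionMatrix μ r T C) :=
  ⟨fun n => toBall X r (T^[n] x), fun n => by
    have : ProperSpace K := ProperSpace.of_locallyCompactSpace K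
    have hne : (toBall X r (T^[n] x)).1 ∩ T ⁻¹' (toBall X r (T^[n + 1] x)).1 ≠ ∅ := by
      refine Set.Nonempty.ne_empty ⟨T^[n] x, h.mem_toBall _, ?_⟩
      rw [Set.mem_preimage, ← Function.iterate_succ_apply' T n x]
      exact h.mem_toBall _
    have hC : 0 < 1 / C (toBall X r (T^[n] x)).rep :=
      one_div_pos.2 (zero_lt_one.trans_le (h.one_le _))
    rw [transitionMatrix, if_neg hne, Measure.real, ENNReal.toReal_ne_zero]
    exact ⟨(Metric.measure_closedBall_pos μ 0 hC).ne', measure_closedBall_lt_top.ne⟩⟩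

/-- `Φ⁻¹ (X_{A_k})`, where `X_{A_k}` is regarded as the set of those sequences in `X_A` whose
entries all belong to the class `P`. -/
def piece (h : IsLocallyScaling X r T C) (P : Set (BallClass X r)) : Set X :=
  h.coding μ ⁻¹' {s | ∀ n, s.seq n ∈ P}

theorem mapsTo_piece (h : IsLocallyScaling X r T C) (P : Set (BallClass X r)) :
    MapsTo T (h.piece μ P) (h.piece μ P) := by
  intro x hx n
  exact hx (n + 1)

/-- The restriction of `(X, μ, T)` to `Φ⁻¹ (X_{A_k})`. -/
noncomputable def pieceSystem (h : IsLocallyScaling X r T C) (P : Set (BallClass X r)) :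
    DynSystem.{u} :=
  (spaceSystem μ T).restrict (h.piece μ P) (h.mapsTo_piece μ P)

/-- The Markov shift of the block `A_k`. -/
noncomputable def blockShift (_h : IsLocallyScaling X r T C) (P : Set (BallClass X r)) :
    DynSystem.{u} :=
  markovShift ((transitionMatrix μ r T C).block P) (ballVector μ r)

open Classical in
/-- The restriction of `(X, μ, T)` to `Φ⁻¹ (X_{A_k})` if `X_{A_k}` is finite, and the Markov
shift of the block `A_k` otherwise. -/
noncomputable def modelSystem (h : IsLocallyScaling X r T C) (P : Set (BallClass X r)) :
    DynSystem.{u} :=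
  if Finite (ShiftSpace ((transitionMatrix μ r T C).block P)) then h.pieceSystem μ P
  else h.blockShift μ P

end IsLocallyScaling

end LocallyScaling

/-!
The map `T` carries the ball `B_ρ(x)`, for `ρ ≤ r`, onto the whole ball `B_{C(x) ρ}(T x)`: after
division by an element of absolute value `C(x)` it is an isometry of a compact ball into itself,
hence surjective (`IsLocallyScaling.exists_map_eq`). So the points whose first `ℓ + 1` iterates
visit prescribed `r`-balls form either the empty set or a ball of radius `r / ∏ C`, and, the Haar
measure of a ball being multiplicative in its radius, its measure is the one that the Markov measure
assigns to the corresponding cylinder set (`IsLocallyScaling.preimage_cyl_eq`). Thus the coding map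
`Φ` carries `μ|_X` to the Markov measure; by compactness it is surjective. The transition matrix
inherits its properties from there: its rows sum to `1` because cylinder sets are split by their
next entry, and its columns sum to `1` because `T` preserves `μ`.

For a doubly stochastic matrix a set of states closed under successors is closed under predecessors
(`IsStochastic.closed_backward`). Reachability is therefore an equivalence relation, whose classes
give the irreducible decomposition, and every sequence of `X_A` remains in one class; this splits
both systems into clopen invariant pieces.

If `X_{A_k}` is finite, its shift is bijective, so that all non-zero entries of `A_k` are `1` and
all scaling factors on the piece are `1`. If it is infinite, then by irreducibility every sequence
passes infinitely often through a state with several successors, at which `T` expands by a factor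
bounded away from `1`; two points of the piece with the same itinerary therefore coincide. So `Φ` is
a continuous bijection of compact Hausdorff spaces over `X_{A_k}`, hence an isomorphism.

For the ergodicity of an irreducible Markov shift (`IsMarkovMeasure.preErgodic_shift`) let `E` be
invariant. The conditional measure of `E` given the first entry is a harmonic function on the
states, hence constant, so that `E` is independent of all cylinder sets and thus of itself.
-/

/-! ### Irreducible and doubly stochastic matrices -/

/-- A non-empty set of states of an irreducible matrix that is closed under transitions is
everything. -/
theorem Matrix.IsIrreducible.eq_univ_of_closed {H : Type*} {A : Matrix H H ℝ}
    (hA : A.IsIrreducible) {S : Set H} (hne : S.Nonempty)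
    (hS : ∀ i ∈ S, ∀ j, 0 < A i j → j ∈ S) : S = univ := by
  let : Quiver H := A.toQuiver
  obtain ⟨i, hi⟩ := hne
  refine eq_univ_of_forall fun j => ?_
  obtain ⟨p, -⟩ := hA.connected i j
  induction p with
  | nil => exact hi
  | cons q e ih => exact hS _ ih _ e.down

theorem Matrix.isIrreducible_of_transGen {H : Type*} {A : Matrix H H ℝ}
    (hnn : ∀ i j, 0 ≤ A i j) (hA : ∀ i j, Relation.TransGen (fun a b => 0 < A a b) i j) :
    A.IsIrreducible := by
  let : Quiver H := A.toQuiver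
  refine ⟨hnn, fun i j => ?_⟩
  induction hA i j with
  | single h => exact ⟨Quiver.Path.nil.cons (PLift.up h), Nat.succ_pos _⟩
  | tail _ h ih =>
    obtain ⟨p, -⟩ := ih
    exact ⟨p.cons (PLift.up h), Nat.succ_pos _⟩

theorem IsStochastic.exists_pos {H : Type*} [Fintype H] {A : Matrix H H ℝ} (hA : IsStochastic A)
    (i : H) : ∃ j, 0 < A i j := by
  by_contra! hcon
  have := hA.row_sum i
  rw [Finset.sum_eq_zero fun j _ => le_antisymm (hcon j) (hA.nonneg i j)] at this
  exact zero_ne_one this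

/-- A set of states of a doubly stochastic matrix that is closed under successors is closed under
predecessors: the rows of the set carry total mass `|S|`, all of it in the columns of the set,
which carry total mass `|S|` as well. -/
theorem IsStochastic.closed_backward {H : Type*} [Fintype H] {A : Matrix H H ℝ}
    (hA : IsStochastic A) (hc : ∀ j, ∑ i, A i j = 1) {S : Set H}
    (hS : ∀ i ∈ S, ∀ j, 0 < A i j → j ∈ S) {i j : H} (hj : j ∈ S) (hij : 0 < A i j) : i ∈ S := by
  classical
  by_contra hi
  have hrow : ∀ a ∈ S.toFinset, ∑ b ∈ S.toFinset, A a b = 1 := by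
    intro a ha
    rw [← hA.row_sum a]
    refine Finset.sum_subset (Finset.subset_univ _) fun b _ hb => ?_
    by_contra hne
    exact hb (by simpa using hS a (by simpa using ha) b ((hA.nonneg a b).lt_of_ne' hne))
  have hcol : ∀ b ∈ S.toFinset, ∑ a ∈ S.toFinset, A a b ≤ 1 := by
    intro b _
    rw [← hc b]
    exact Finset.sum_le_sum_of_subset_of_nonneg (Finset.subset_univ _) fun a _ _ => hA.nonneg a b
  -- the entry `A i j` is missing from the part of column `j` inside the set
  have hlt : ∑ a ∈ S.toFinset, A a j < 1 := by
    rw [← hc j]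
    exact Finset.sum_lt_sum_of_subset (Finset.subset_univ _) (Finset.mem_univ i) (by simpa using hi)
      hij fun a _ _ => hA.nonneg a j
  have h1 : ∑ b ∈ S.toFinset, ∑ a ∈ S.toFinset, A a b < ∑ b ∈ S.toFinset, (1 : ℝ) :=
    Finset.sum_lt_sum hcol ⟨j, by simpa using hj, hlt⟩
  rw [Finset.sum_comm, Finset.sum_congr rfl hrow] at h1
  exact lt_irrefl _ h1

/-- A doubly stochastic matrix is block diagonal with irreducible blocks: reachability is
symmetric, hence an equivalence relation. -/
theorem IsStochastic.exists_isIrreducibleDecomposition {H : Type u} [Fintype H]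
    {A : Matrix H H ℝ} (hA : IsStochastic A) (hc : ∀ j, ∑ i, A i j = 1) :
    ∃ (n : ℕ) (P : Fin n → Set H), IsIrreducibleDecomposition A P := by
  let R : H → H → Prop := Relation.ReflTransGen fun a b => 0 < A a b
  have hsymm : ∀ {i j}, R i j → R j i := by
    intro i j hij
    induction hij with
    | refl => exact .refl
    | tail _ hbc ih =>
      exact .trans (hA.closed_backward hc (S := {a | R _ a}) (fun a ha b hab => ha.tail hab)
        Relation.ReflTransGen.refl hbc) ih
  let s : Setoid H := ⟨R, ⟨fun _ => .refl, hsymm, fun h h' => h.trans h'⟩⟩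
  have : Finite (Quotient s) := Quotient.finite s
  obtain ⟨n, ⟨e⟩⟩ := Finite.exists_equiv_fin (Quotient s)
  have hR : ∀ {i j}, e ⟦i⟧ = e ⟦j⟧ ↔ R i j := fun {i j} =>
    e.injective.eq_iff.trans Quotient.eq
  refine ⟨n, fun k => {i | e ⟦i⟧ = k}, ?_, ?_, ?_, ?_, ?_⟩
  · intro k
    obtain ⟨q, rfl⟩ := e.surjective k
    obtain ⟨i, rfl⟩ := Quotient.exists_rep q
    exact ⟨i, rfl⟩
  · exact fun k l hkl => Set.disjoint_left.2 fun i hk hl => hkl (hk.symm.trans hl)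
  · exact eq_univ_of_forall fun i => mem_iUnion.2 ⟨_, rfl⟩
  · intro k l hkl i hi j hj
    by_contra hne
    refine hkl (hi.symm.trans (Eq.trans ?_ hj))
    exact hR.2 (.single ((hA.nonneg i j).lt_of_ne' hne))
  · intro k
    refine Matrix.isIrreducible_of_transGen (fun i j => hA.nonneg _ _) ?_
    rintro ⟨i, hi⟩ ⟨j, hj⟩
    have hij : Relation.TransGen (fun a b => 0 < A a b) i j := by
      obtain ⟨a, ha⟩ := hA.exists_pos i
      exact .head' ha ((hsymm (.single ha)).trans (hR.1 (hi.trans hj.symm)))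
    induction hij with
    | single h => exact .single h
    | tail hab hbc ih =>
      have hb := (hR.2 hab.to_reflTransGen).symm.trans hi
      exact (ih hb).tail hbc

/-- The maximum principle: a harmonic function of an irreducible stochastic matrix is constant. -/
theorem IsStochastic.harmonic_const {H : Type*} [Fintype H] {A : Matrix H H ℝ}
    (hA : IsStochastic A) (hirr : A.IsIrreducible) {g : H → ℝ}
    (hg : ∀ i, g i = ∑ j, A i j * g j) : ∃ c, ∀ i, g i = c := by
  rcases isEmpty_or_nonempty H with hH | hH
  · exact ⟨0, fun i => hH.elim i⟩
  obtain ⟨i₀, hi₀⟩ := Finite.exists_max g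
  have huniv : {i | g i = g i₀} = univ := by
    refine hirr.eq_univ_of_closed ⟨i₀, rfl⟩ fun i hi j hij => ?_
    have hsum : ∑ j, A i j * (g i₀ - g j) = 0 := by
      simp only [mul_sub, Finset.sum_sub_distrib, ← Finset.sum_mul, hA.row_sum, one_mul]
      rw [← hg i, hi, sub_self]
    have h0 := (Finset.sum_eq_zero_iff_of_nonneg fun j _ =>
      mul_nonneg (hA.nonneg i j) (sub_nonneg.2 (hi₀ j))).1 hsum j (Finset.mem_univ j)
    exact (sub_eq_zero.1 ((mul_eq_zero.1 h0).resolve_left hij.ne')).symm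
  exact ⟨g i₀, fun i => huniv.ge (mem_univ i)⟩

namespace IsIrreducibleDecomposition

variable {H : Type u} {A : Matrix H H ℝ} {n : ℕ} {P : Fin n → Set H}

theorem mem_iff (hP : IsIrreducibleDecomposition A P) {k : Fin n} {i j : H} (hij : A i j ≠ 0) :
    i ∈ P k ↔ j ∈ P k := by
  obtain ⟨a, ha⟩ := mem_iUnion.1 (hP.cover.ge (mem_univ i))
  obtain ⟨b, hb⟩ := mem_iUnion.1 (hP.cover.ge (mem_univ j))
  have hab : a = b := by
    by_contra hne
    exact hij (hP.off_diagonal a b hne i ha j hb)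
  subst hab
  have huniq : ∀ {x}, x ∈ P a → x ∈ P k → a = k := fun {x} h h' => by
    by_contra hne
    exact Set.disjoint_left.1 (hP.disjoint hne) h h'
  exact ⟨fun h => huniq ha h ▸ hb, fun h => huniq hb h ▸ ha⟩

theorem isStochastic_block [Fintype H] (hP : IsIrreducibleDecomposition A P)
    (hA : IsStochastic A) (k : Fin n) [Fintype (P k)] : IsStochastic (A.block (P k)) := by
  classical
  refine ⟨fun i j => hA.nonneg _ _, fun i => ?_⟩
  rw [← hA.row_sum i]
  refine Eq.trans (Finset.sum_subtype (P k).toFinset (by simp) fun j => A i j).symm ?_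
  refine Finset.sum_subset (Finset.subset_univ _) fun j _ hj => ?_
  by_contra hne
  exact hj (by simpa using (hP.mem_iff hne).1 i.2)

theorem block_col_sum [Fintype H] (hP : IsIrreducibleDecomposition A P)
    (hc : ∀ j, ∑ i, A i j = 1) (k : Fin n) [Fintype (P k)] (j : P k) :
    ∑ i, A.block (P k) i j = 1 := by
  classical
  rw [← hc j]
  refine Eq.trans (Finset.sum_subtype (P k).toFinset (by simp) fun i => A i j).symm ?_
  refine Finset.sum_subset (Finset.subset_univ _) fun i _ hi => ?_
  by_contra hne
  exact hi (by simpa using (hP.mem_iff hne).2 j.2)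

end IsIrreducibleDecomposition

/-! ### Shift spaces -/

namespace ShiftSpace

variable {H : Type u} {A : Matrix H H ℝ}

instance instBorelSpace : BorelSpace (ShiftSpace A) := ⟨rfl⟩

theorem isLocallyConstant_seq (n : ℕ) : IsLocallyConstant fun x : ShiftSpace A => x.seq n := by
  let : TopologicalSpace H := ⊥
  have : DiscreteTopology H := ⟨rfl⟩
  rw [IsLocallyConstant.iff_continuous]
  exact (continuous_apply n).comp continuous_induced_dom

theorem continuous_of_isLocallyConstant {Y : Type*} [TopologicalSpace Y] {f : Y → ShiftSpace A}
    (hf : ∀ n, IsLocallyConstant fun y => (f y).seq n) : Continuous f := by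
  let : TopologicalSpace H := ⊥
  have : DiscreteTopology H := ⟨rfl⟩
  exact continuous_induced_rng.2 (continuous_pi fun n => (hf n).continuous)

instance instT2Space : T2Space (ShiftSpace A) := by
  let : TopologicalSpace H := ⊥
  have : DiscreteTopology H := ⟨rfl⟩
  exact T2Space.of_injective_continuous (f := (seq : ShiftSpace A → ℕ → H))
    (fun x y h => Subtype.ext h) continuous_induced_dom

theorem ext {x y : ShiftSpace A} (h : ∀ n, x.seq n = y.seq n) : x = y := Subtype.ext (funext h)

theorem continuous_shift : Continuous (shift A) :=
  continuous_of_isLocallyConstant fun n => isLocallyConstant_seq (n + 1)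

theorem measurableSet_seq_eq (n : ℕ) (i : H) : MeasurableSet {x : ShiftSpace A | x.seq n = i} :=
  ((isLocallyConstant_seq n).isOpen_fiber i).measurableSet

theorem measurableSet_cyl {ℓ : ℕ} (d : Fin (ℓ + 1) → H) : MeasurableSet (cyl A d) := by
  rw [cyl, Set.ofPred_forall]
  exact MeasurableSet.iInter fun n => measurableSet_seq_eq n (d n)

theorem cyl_const (i : H) : cyl A (fun _ : Fin 1 => i) = {x | x.seq 0 = i} := by
  ext x
  exact ⟨fun h => h 0, fun h n => by obtain rfl := Fin.fin_one_eq_zero n; exact h⟩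

theorem cyl_cons {ℓ : ℕ} (i : H) (d : Fin (ℓ + 1) → H) :
    cyl A (Fin.cons i d : Fin (ℓ + 1 + 1) → H) = {x | x.seq 0 = i} ∩ shift A ⁻¹' cyl A d := by
  ext x
  constructor
  · intro h
    refine ⟨h 0, fun n => ?_⟩
    have hn := h n.succ
    rw [Fin.val_succ, Fin.cons_succ] at hn
    exact hn
  · rintro ⟨h0, h1⟩ n
    cases n using Fin.cases with
    | zero => exact h0
    | succ n =>
      rw [Fin.val_succ, Fin.cons_succ]
      exact h1 n

theorem prod_cons {ℓ : ℕ} (i : H) (d : Fin (ℓ + 1) → H) :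
    ∏ n : Fin (ℓ + 1), A ((Fin.cons i d : Fin (ℓ + 1 + 1) → H) n.castSucc)
      ((Fin.cons i d : Fin (ℓ + 1 + 1) → H) n.succ) =
      A i (d 0) * ∏ n : Fin ℓ, A (d n.castSucc) (d n.succ) := by
  rw [Fin.prod_univ_succ]
  congr 1

/-- The sequence `i, x₀, x₁, …`. -/
def cons (i : H) (x : ShiftSpace A) (h : A i (x.seq 0) ≠ 0) : ShiftSpace A :=
  ⟨fun n => n.casesOn i x.seq, fun n => by
    cases n with
    | zero => exact h
    | succ n => exact x.2 n⟩

theorem exists_seq_zero_eq (hA : ∀ i, ∃ j, A i j ≠ 0) (i : H) :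
    ∃ x : ShiftSpace A, x.seq 0 = i := by
  choose f hf using hA
  refine ⟨⟨fun n => f^[n] i, fun n => ?_⟩, rfl⟩
  have h := hf (f^[n] i)
  rwa [← Function.iterate_succ_apply' f n i] at h

/-- If the shift space of a doubly stochastic matrix is finite, then the shift, being surjective,
is bijective; so every state has a single predecessor, and all non-zero entries are `1`. -/
theorem eq_one_of_finite [Fintype H] (hA : IsStochastic A) (hc : ∀ j, ∑ i, A i j = 1)
    [Finite (ShiftSpace A)] {i j : H} (hij : A i j ≠ 0) : A i j = 1 := by
  have hsurj : Function.Surjective (shift A) := by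
    intro x
    have : ∃ i, A i (x.seq 0) ≠ 0 := by
      by_contra! hcon
      have h0 := hc (x.seq 0)
      rw [Finset.sum_eq_zero fun i _ => hcon i] at h0
      exact zero_ne_one h0
    obtain ⟨i, hi⟩ := this
    exact ⟨cons i x hi, rfl⟩
  have hinj := Finite.injective_iff_surjective.2 hsurj
  obtain ⟨x, rfl⟩ := exists_seq_zero_eq (fun i => (hA.exists_pos i).imp fun _ h => h.ne') j
  rw [← hc (x.seq 0)]
  refine Eq.symm (Finset.sum_eq_single_of_mem (f := fun a => A a (x.seq 0)) i
    (Finset.mem_univ i) fun i' _ hne => ?_)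
  by_contra h'
  have heq : cons i' x h' = cons i x hij := hinj rfl
  exact hne (congrArg (fun y : ShiftSpace A => y.seq 0) heq)

/-- If the shift space of an irreducible matrix is infinite, then every sequence passes infinitely
often through a state with several successors: otherwise the states visited from some time on
form a closed set, hence are all states, and each sequence is determined by its first entry. -/
theorem exists_branching [Finite H] (hirr : A.IsIrreducible) [Infinite (ShiftSpace A)]
    (x : ShiftSpace A) (n : ℕ) : ∃ m ≥ n, ∃ j ≠ x.seq (m + 1), A (x.seq m) j ≠ 0 := by
  by_contra! hcon
  have huniv : {i | ∃ m ≥ n, x.seq m = i} = univ := by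
    refine hirr.eq_univ_of_closed ⟨_, n, le_rfl, rfl⟩ ?_
    rintro _ ⟨m, hm, rfl⟩ j hj
    refine ⟨m + 1, by omega, ?_⟩
    by_contra hne
    exact hj.ne' (hcon m hm j (Ne.symm hne))
  -- all states being visited, each has only one successor
  have hdet : ∀ i j j', A i j ≠ 0 → A i j' ≠ 0 → j = j' := by
    intro i j j' hj hj'
    obtain ⟨m, hm, rfl⟩ := huniv.ge (mem_univ i)
    have key : ∀ j, A (x.seq m) j ≠ 0 → j = x.seq (m + 1) := fun j hj => by
      by_contra hne
      exact hj (hcon m hm j hne)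
    rw [key j hj, key j' hj']
  have hinj : Function.Injective fun y : ShiftSpace A => y.seq 0 := by
    intro y z hyz
    refine ext fun m => ?_
    induction m with
    | zero => exact hyz
    | succ m ih =>
      have hz : A (z.seq m) (z.seq (m + 1)) ≠ 0 := z.2 m
      rw [← ih] at hz
      exact hdet _ _ _ (y.2 m) hz
  exact not_finite_iff_infinite.2 ‹_› (Finite.of_injective _ hinj)

end ShiftSpace

/-! ### Markov measures -/

namespace IsMarkovMeasure

variable {H : Type u} {A : Matrix H H ℝ} {v : H → ℝ} {ν : Measure (ShiftSpace A)}

theorem apply_seq_zero (hν : IsMarkovMeasure A v ν) (i : H) :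
    ν {x | x.seq 0 = i} = ENNReal.ofReal (v i) := by
  rw [← ShiftSpace.cyl_const, hν]
  simp

theorem apply_seq_zero_inter (hν : IsMarkovMeasure A v ν) (i j : H) :
    ν ({x | x.seq 0 = i} ∩ ShiftSpace.shift A ⁻¹' {x | x.seq 0 = j}) =
      ENNReal.ofReal (v i * A i j) := by
  rw [← ShiftSpace.cyl_const j, ← ShiftSpace.cyl_cons, hν, ShiftSpace.prod_cons]
  simp

variable [Fintype H]

theorem isFiniteMeasure (hν : IsMarkovMeasure A v ν) : IsFiniteMeasure ν := by
  have huniv : (⋃ i : H, {x : ShiftSpace A | x.seq 0 = i}) = univ :=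
    eq_univ_of_forall fun x => mem_iUnion.2 ⟨_, rfl⟩
  refine ⟨?_⟩
  rw [← huniv]
  refine (measure_iUnion_fintype_le _ _).trans_lt (ENNReal.sum_lt_top.2 fun i _ => ?_)
  rw [hν.apply_seq_zero]
  exact ENNReal.ofReal_lt_top

/-- A non-negative matrix admitting a Markov measure is stochastic. -/
theorem isStochastic (hA : ∀ i j, 0 ≤ A i j) (hv : ∀ i, 0 < v i) (hν : IsMarkovMeasure A v ν) :
    IsStochastic A := by
  refine ⟨hA, fun i => ?_⟩
  have hU : {x : ShiftSpace A | x.seq 0 = i} =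
      ⋃ j, {x | x.seq 0 = i} ∩ ShiftSpace.shift A ⁻¹' {x | x.seq 0 = j} := by
    ext x
    simp
  have hm : Measurable (ShiftSpace.shift A) := ShiftSpace.continuous_shift.measurable
  have h := hν.apply_seq_zero i
  rw [hU, measure_iUnion _ fun j => (ShiftSpace.measurableSet_seq_eq 0 i).inter
    (hm (ShiftSpace.measurableSet_seq_eq 0 j)), tsum_fintype] at h
  · simp only [hν.apply_seq_zero_inter] at h
    rw [← ENNReal.ofReal_sum_of_nonneg fun j _ => mul_nonneg (hv i).le (hA i j), ← Finset.mul_sum,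
      ENNReal.ofReal_eq_ofReal_iff (mul_nonneg (hv i).le (Finset.sum_nonneg fun j _ => hA i j))
      (hv i).le] at h
    exact mul_left_cancel₀ (hv i).ne' (h.trans (mul_one _).symm)
  · exact fun j j' hne => Set.disjoint_left.2 fun x hx hx' => hne (hx.2.symm.trans hx'.2)

/-- The initial vector of a shift-invariant Markov measure is stationary. -/
theorem stationary (hA : ∀ i j, 0 ≤ A i j) (hv : ∀ i, 0 ≤ v i) (hν : IsMarkovMeasure A v ν)
    (hinv : MeasurePreserving (ShiftSpace.shift A) ν ν) (j : H) : ∑ i, v i * A i j = v j := by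
  have hU : ShiftSpace.shift A ⁻¹' {x : ShiftSpace A | x.seq 0 = j} =
      ⋃ i, {x | x.seq 0 = i} ∩ ShiftSpace.shift A ⁻¹' {x | x.seq 0 = j} := by
    ext x
    simp
  have h := hν.apply_seq_zero j
  rw [← hinv.measure_preimage (ShiftSpace.measurableSet_seq_eq 0 j).nullMeasurableSet, hU,
    measure_iUnion _ fun i => (ShiftSpace.measurableSet_seq_eq 0 i).inter
    (hinv.measurable (ShiftSpace.measurableSet_seq_eq 0 j)), tsum_fintype] at h
  · simp only [hν.apply_seq_zero_inter] at h
    have h0 : ∀ i, 0 ≤ v i * A i j := fun i => mul_nonneg (hv i) (hA i j)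
    rwa [← ENNReal.ofReal_sum_of_nonneg fun i _ => h0 i,
      ENNReal.ofReal_eq_ofReal_iff (Finset.sum_nonneg fun i _ => h0 i) (hv j)] at h
  · exact fun i i' hne => Set.disjoint_left.2 fun x hx hx' => hne (hx.1.symm.trans hx'.1)

/-- The Markov measure of a stationary vector is invariant under the shift. -/
theorem measurePreserving_shift (hA : IsStochastic A) (hv : ∀ i, 0 ≤ v i)
    (hst : ∀ j, ∑ i, v i * A i j = v j) (hν : IsMarkovMeasure A v ν) :
    MeasurePreserving (ShiftSpace.shift A) ν ν := by
  have hm : Measurable (ShiftSpace.shift A) := ShiftSpace.continuous_shift.measurable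
  refine ⟨hm, IsMarkovMeasure.unique (A := A) (v := v) (fun ℓ d => ?_) hν⟩
  rw [Measure.map_apply hm (ShiftSpace.measurableSet_cyl d)]
  have hU : ShiftSpace.shift A ⁻¹' ShiftSpace.cyl A d =
      ⋃ i, ShiftSpace.cyl A (Fin.cons i d : Fin (ℓ + 1 + 1) → H) := by
    ext x
    simp [ShiftSpace.cyl_cons]
  rw [hU, measure_iUnion _ fun i => ShiftSpace.measurableSet_cyl _, tsum_fintype]
  · have hi : ∀ i, ν (ShiftSpace.cyl A (Fin.cons i d : Fin (ℓ + 1 + 1) → H)) =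
        ENNReal.ofReal (v i * (A i (d 0) * ∏ n : Fin ℓ, A (d n.castSucc) (d n.succ))) := by
      intro i
      rw [hν, ShiftSpace.prod_cons, Fin.cons_zero]
    have hprod : 0 ≤ ∏ n : Fin ℓ, A (d n.castSucc) (d n.succ) :=
      Finset.prod_nonneg fun _ _ => hA.nonneg _ _
    rw [Finset.sum_congr rfl fun i _ => hi i, ← ENNReal.ofReal_sum_of_nonneg fun i _ =>
      mul_nonneg (hv i) (mul_nonneg (hA.nonneg _ _) hprod)]
    simp only [← mul_assoc, ← Finset.sum_mul, hst]
  · intro i j hij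
    refine Set.disjoint_left.2 fun x hx hx' => hij ?_
    exact ((ShiftSpace.cyl_cons i d).le hx).1.symm.trans ((ShiftSpace.cyl_cons j d).le hx').1

/-- The Markov property for one step: the image under the shift of the part of a Markov measure on
which the first entry is `i`, in terms of the parts with prescribed first entry. -/
theorem map_shift_restrict (hA : IsStochastic A) (hv : ∀ i, 0 < v i) (hν : IsMarkovMeasure A v ν)
    (i : H) :
    (ν.restrict {x | x.seq 0 = i}).map (ShiftSpace.shift A) =
      ∑ j, ENNReal.ofReal (v i * A i j / v j) • ν.restrict {x | x.seq 0 = j} := by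
  classical
  have hm : Measurable (ShiftSpace.shift A) := ShiftSpace.continuous_shift.measurable
  -- both sides are the Markov measure with initial vector `j ↦ v i * A i j`
  refine IsMarkovMeasure.unique (A := A) (v := fun j => v i * A i j) (fun ℓ d => ?_) fun ℓ d => ?_
  · rw [Measure.map_apply hm (ShiftSpace.measurableSet_cyl d),
      Measure.restrict_apply (hm (ShiftSpace.measurableSet_cyl d)), inter_comm,
      ← ShiftSpace.cyl_cons, hν, ShiftSpace.prod_cons, Fin.cons_zero, mul_assoc]
  · have hj : ∀ j, ν.restrict {x | x.seq 0 = j} (ShiftSpace.cyl A d) =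
        if j = d 0 then ν (ShiftSpace.cyl A d) else 0 := by
      intro j
      rw [Measure.restrict_apply (ShiftSpace.measurableSet_cyl d)]
      split_ifs with h
      · congr 1
        refine inter_eq_left.2 fun x hx => ?_
        exact (hx 0).trans h.symm
      · convert measure_empty (μ := ν)
        refine Set.disjoint_iff_inter_eq_empty.1 (Set.disjoint_left.2 fun x hx hx' => h ?_)
        exact hx'.symm.trans (hx 0)
    simp only [Measure.coe_finsetSum, Measure.coe_smul, Finset.sum_apply, Pi.smul_apply,
      smul_eq_mul, hj, mul_ite, mul_zero, Finset.sum_ite_eq', Finset.mem_univ, if_true]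
    rw [hν, ← ENNReal.ofReal_mul (div_nonneg (mul_nonneg (hv _).le (hA.nonneg _ _)) (hv _).le)]
    congr 1
    field_simp [(hv (d 0)).ne']

/-- The measure of a set cut out by its first entry and its shift. -/
theorem measure_inter_preimage_shift (hA : IsStochastic A) (hv : ∀ i, 0 < v i)
    (hν : IsMarkovMeasure A v ν) (i : H) {E : Set (ShiftSpace A)} (hE : MeasurableSet E) :
    ν ({x | x.seq 0 = i} ∩ ShiftSpace.shift A ⁻¹' E) =
      ∑ j, ENNReal.ofReal (v i * A i j / v j) * ν ({x | x.seq 0 = j} ∩ E) := by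
  have hm : Measurable (ShiftSpace.shift A) := ShiftSpace.continuous_shift.measurable
  have h := congrArg (fun ρ => ρ E) (hν.map_shift_restrict hA hv i)
  simp only [Measure.map_apply hm hE, Measure.restrict_apply (hm hE), Measure.coe_finsetSum,
    Measure.coe_smul, Finset.sum_apply, Pi.smul_apply, smul_eq_mul,
    Measure.restrict_apply hE] at h
  rw [inter_comm, h]
  exact Finset.sum_congr rfl fun j _ => by rw [inter_comm]

/-- An irreducible Markov shift is ergodic. For an invariant set `E`, the conditional measure `g i`
of `E` given that the first entry is `i` is a harmonic function of `i`, hence a constant `c`.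
By the Markov property `ν (E ∩ [d]) = c * ν [d]` for all cylinders `[d]`, so that `ν|_E = c • ν`,
and evaluation at the complement of `E` shows that `E` is null or conull. -/
theorem preErgodic_shift (hA : IsStochastic A) (hirr : A.IsIrreducible) (hv : ∀ i, 0 < v i)
    (hν : IsMarkovMeasure A v ν) : PreErgodic (ShiftSpace.shift A) ν := by
  have := hν.isFiniteMeasure
  refine ⟨fun E hE hinv => ?_⟩
  let g : H → ℝ := fun i => ν.real ({x | x.seq 0 = i} ∩ E) / v i
  have hg0 : ∀ i, 0 ≤ g i := fun i => div_nonneg measureReal_nonneg (hv i).le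
  have hgE : ∀ i, ν ({x | x.seq 0 = i} ∩ E) = ENNReal.ofReal (v i * g i) := by
    intro i
    rw [mul_div_cancel₀ _ (hv i).ne', ofReal_measureReal]
  have hstep : ∀ i j, 0 ≤ v i * A i j / v j := fun i j =>
    div_nonneg (mul_nonneg (hv _).le (hA.nonneg _ _)) (hv _).le
  have hharm : ∀ i, g i = ∑ j, A i j * g j := by
    intro i
    have h := hν.measure_inter_preimage_shift hA hv i hE
    simp only [hinv, hgE] at h
    simp only [← ENNReal.ofReal_mul (hstep _ _)] at h
    rw [← ENNReal.ofReal_sum_of_nonneg fun j _ => mul_nonneg (hstep i j)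
      (mul_nonneg (hv j).le (hg0 j)), ENNReal.ofReal_eq_ofReal_iff (mul_nonneg (hv i).le (hg0 i))
      (Finset.sum_nonneg fun j _ => mul_nonneg (hstep i j) (mul_nonneg (hv j).le (hg0 j)))] at h
    refine mul_left_cancel₀ (hv i).ne' (h.trans ?_)
    rw [Finset.mul_sum]
    refine Finset.sum_congr rfl fun j _ => ?_
    have := (hv j).ne'
    field_simp
  obtain ⟨c, hc⟩ := hA.harmonic_const hirr hharm
  have hcyl : IsMarkovMeasure A (fun i => v i * c) (ν.restrict E) := by
    intro ℓ d
    rw [Measure.restrict_apply (ShiftSpace.measurableSet_cyl d)]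
    induction ℓ with
    | zero =>
      obtain ⟨i, rfl⟩ : ∃ i, d = fun _ => i := ⟨d 0, funext fun n => by rw [Fin.fin_one_eq_zero n]⟩
      rw [ShiftSpace.cyl_const, hgE, hc]
      simp
    | succ ℓ ih =>
      obtain ⟨i, d, rfl⟩ : ∃ i d', d = Fin.cons i d' := ⟨_, _, (Fin.cons_self_tail d).symm⟩
      have hset : ShiftSpace.cyl A (Fin.cons i d : Fin (ℓ + 1 + 1) → H) ∩ E =
          {x | x.seq 0 = i} ∩ ShiftSpace.shift A ⁻¹' (ShiftSpace.cyl A d ∩ E) := by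
        rw [ShiftSpace.cyl_cons, preimage_inter, hinv, inter_assoc]
      rw [hset, hν.measure_inter_preimage_shift hA hv i
        ((ShiftSpace.measurableSet_cyl d).inter hE), Finset.sum_eq_single_of_mem (d 0)
        (Finset.mem_univ _), ShiftSpace.prod_cons, Fin.cons_zero]
      · have hsub : {x | x.seq 0 = d 0} ∩ (ShiftSpace.cyl A d ∩ E) = ShiftSpace.cyl A d ∩ E :=
          inter_eq_right.2 fun x hx => hx.1 0
        rw [hsub, ih, ← ENNReal.ofReal_mul (hstep _ _)]
        congr 1
        have := (hv (d 0)).ne'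
        field_simp
      · intro j _ hj
        have hemp : {x | x.seq 0 = j} ∩ (ShiftSpace.cyl A d ∩ E) = ∅ :=
          Set.disjoint_iff_inter_eq_empty.1 (Set.disjoint_left.2 fun x hx hx' =>
            hj (hx.symm.trans (hx'.1 0)))
        rw [hemp, measure_empty, mul_zero]
  have hsmul : IsMarkovMeasure A (fun i => v i * c) (ENNReal.ofReal c • ν) := by
    intro ℓ d
    rw [Measure.smul_apply, hν, smul_eq_mul, ← ENNReal.ofReal_mul' ]
    · congr 1
      ring
    · exact mul_nonneg (hv _).le (Finset.prod_nonneg fun _ _ => hA.nonneg _ _)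
  have heq := hcyl.unique hsmul
  -- `ν.restrict E` vanishes on the complement of `E`
  have h0 : ENNReal.ofReal c * ν Eᶜ = 0 := by
    have h := congrArg (fun ρ => ρ Eᶜ) heq
    simpa [Measure.restrict_apply hE.compl] using h.symm
  rw [Filter.eventuallyConst_set']
  rcases mul_eq_zero.1 h0 with h | h
  · left
    rw [ae_eq_empty]
    have h' := congrArg (fun ρ => ρ univ) heq
    simpa [h] using h'
  · right
    rwa [ae_eq_univ]

end IsMarkovMeasure

/-! ### Isomorphisms of systems -/

namespace DynSystem

/-- A homeomorphism of Borel spaces carrying the first measure to the second one is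
measure-preserving in both directions. -/
theorem Iso.of_homeomorph {S R : DynSystem.{u}} [BorelSpace S.carrier] [BorelSpace R.carrier]
    (e : S.carrier ≃ₜ R.carrier) (he : MeasurePreserving e S.measure R.measure)
    (hmap : ∀ x, e (S.map x) = R.map (e x)) : S.Iso R :=
  ⟨e, he, he.symm e.toMeasurableEquiv, hmap⟩

theorem Iso.refl (S : DynSystem.{u}) : S.Iso S :=
  ⟨Homeomorph.refl _, MeasurePreserving.id _, MeasurePreserving.id _, fun _ => rfl⟩

theorem Iso.trans {S R Q : DynSystem.{u}} (h : S.Iso R) (h' : R.Iso Q) : S.Iso Q := by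
  obtain ⟨e, he, hes, hm⟩ := h
  obtain ⟨f, hf, hfs, hm'⟩ := h'
  exact ⟨e.trans f, hf.comp he, hes.comp hfs, fun x => (congrArg f (hm x)).trans (hm' _)⟩

theorem measurable_sigmaMk {n : ℕ} (S : Fin n → DynSystem.{u}) (k : Fin n) :
    Measurable (Sigma.mk (β := fun k => (S k).carrier) k) :=
  measurable_iff_le_map.2 (iInf_le _ k)

theorem measurable_of_sigma {n : ℕ} {S : Fin n → DynSystem.{u}} {Y : Type*} [MeasurableSpace Y]
    {f : (Σ k, (S k).carrier) → Y} (hf : ∀ k, Measurable fun x : (S k).carrier => f ⟨k, x⟩) :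
    Measurable f :=
  fun _ hs => MeasurableSpace.measurableSet_iInf.2 fun k => hf k hs

/-- A family of maps preserving the measures preserves the measures of the disjoint unions. -/
theorem measurePreserving_sigma {n : ℕ} {S R : Fin n → DynSystem.{u}}
    {f : ∀ k, (S k).carrier → (R k).carrier}
    (hf : ∀ k, MeasurePreserving (f k) (S k).measure (R k).measure) :
    MeasurePreserving (fun x : Σ k, (S k).carrier => (⟨x.1, f x.1 x.2⟩ : Σ k, (R k).carrier))
      (disjointUnion S).measure (disjointUnion R).measure := by
  have hm : Measurable fun x : Σ k, (S k).carrier => (⟨x.1, f x.1 x.2⟩ : Σ k, (R k).carrier) :=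
    measurable_of_sigma fun k => (measurable_sigmaMk R k).comp (hf k).measurable
  refine ⟨hm, ?_⟩
  refine (Measure.map_sum hm.aemeasurable).trans ?_
  refine congrArg Measure.sum (funext fun k => ?_)
  rw [Measure.map_map hm (measurable_sigmaMk S k), ← (hf k).map_eq,
    Measure.map_map (measurable_sigmaMk R k) (hf k).measurable]
  rfl

theorem Iso.disjointUnion {n : ℕ} {S R : Fin n → DynSystem.{u}} (h : ∀ k, (S k).Iso (R k)) :
    (disjointUnion S).Iso (disjointUnion R) := by
  choose e he hes hm using h
  refine ⟨⟨Equiv.sigmaCongrRight fun k => (e k).toEquiv, ?_, ?_⟩, ?_, ?_, ?_⟩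
  · exact continuous_sigma fun k => continuous_sigmaMk.comp (e k).continuous
  · exact continuous_sigma fun k => continuous_sigmaMk.comp (e k).symm.continuous
  · exact measurePreserving_sigma he
  · exact measurePreserving_sigma hes
  · rintro ⟨k, x⟩
    exact congrArg (Sigma.mk k) (hm k x)

/-- A system is the disjoint union of its restrictions to the members of a finite partition into
invariant open sets. -/
theorem iso_disjointUnion_restrict (S : DynSystem.{u}) [OpensMeasurableSpace S.carrier] {n : ℕ}
    {Y : Fin n → Set S.carrier} (hY : ∀ k, MapsTo S.map (Y k) (Y k)) (hopen : ∀ k, IsOpen (Y k))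
    (hdisj : Pairwise fun k l => Disjoint (Y k) (Y l)) (hcover : ⋃ k, Y k = univ) :
    S.Iso (DynSystem.disjointUnion fun k => S.restrict (Y k) (hY k)) := by
  let f : (DynSystem.disjointUnion fun k => S.restrict (Y k) (hY k)).carrier → S.carrier :=
    fun x => x.2.1
  have hcont : Continuous f := continuous_sigma fun k => continuous_subtype_val
  have hmeas : Measurable f := measurable_of_sigma fun k => measurable_subtype_coe
  have hbij : Function.Bijective f := by
    constructor
    · rintro ⟨k, x, hx⟩ ⟨l, y, hy⟩ hxy
      obtain rfl : x = y := hxy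
      obtain rfl : k = l := by
        by_contra hne
        exact Set.disjoint_left.1 (hdisj hne) hx hy
      rfl
    · intro x
      obtain ⟨k, hk⟩ := mem_iUnion.1 (hcover.ge (mem_univ x))
      exact ⟨⟨k, x, hk⟩, rfl⟩
  have hopenmap : IsOpenMap f := isOpenMap_sigma.2 fun k => (hopen k).isOpenMap_subtype_val
  let e := (Equiv.ofBijective f hbij).toHomeomorphOfContinuousOpen hcont hopenmap
  have hsymm : ∀ x, f (e.symm x) = x := e.apply_symm_apply
  have hemeas : Measurable e.symm := by
    intro s hs
    have hpre : e.symm ⁻¹' s = ⋃ k, Subtype.val '' (Sigma.mk (β := fun k => Y k) k ⁻¹' s) := by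
      ext x
      simp only [mem_preimage, mem_iUnion, mem_image]
      constructor
      · intro hx
        exact ⟨(e.symm x).1, (e.symm x).2, hx, hsymm x⟩
      · rintro ⟨k, y, hy, rfl⟩
        have : e.symm (f ⟨k, y⟩) = ⟨k, y⟩ := e.symm_apply_apply _
        exact this.symm ▸ hy
    rw [hpre]
    refine MeasurableSet.iUnion fun k => ?_
    exact (MeasurableEmbedding.subtype_coe (hopen k).measurableSet).measurableSet_image.2
      (measurable_sigmaMk (fun k => S.restrict (Y k) (hY k)) k hs)
  have hpres : MeasurePreserving f
      (DynSystem.disjointUnion fun k => S.restrict (Y k) (hY k)).measure S.measure := by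
    refine ⟨hmeas, ?_⟩
    refine (Measure.map_sum hmeas.aemeasurable).trans ?_
    have hk : ∀ k, ((S.restrict (Y k) (hY k)).measure.map (Sigma.mk k)).map f =
        S.measure.restrict (Y k) := by
      intro k
      refine (Measure.map_map hmeas
        (measurable_sigmaMk (fun k => S.restrict (Y k) (hY k)) k)).trans ?_
      exact map_comap_subtype_coe (hopen k).measurableSet _
    refine (congrArg Measure.sum (funext hk)).trans ?_
    rw [← Measure.restrict_iUnion hdisj fun k => (hopen k).measurableSet, hcover,
      Measure.restrict_univ]
  refine ⟨e.symm, ?_, hpres, fun x => ?_⟩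
  · exact hpres.symm ⟨e.toEquiv, hmeas, hemeas⟩
  · apply e.injective
    rw [e.apply_symm_apply]
    exact congrArg S.map (hsymm x).symm

/-- A continuous factor map that is bijective over a measurable set, with compact preimage of that
set, is an isomorphism over it. -/
theorem Iso.restrict_preimage {S R : DynSystem.{u}} [BorelSpace S.carrier]
    [BorelSpace R.carrier] [T2Space R.carrier] {f : S.carrier → R.carrier} (hf : Continuous f)
    (hpres : MeasurePreserving f S.measure R.measure) (hmap : ∀ x, f (S.map x) = R.map (f x))
    {Y : Set R.carrier} (hY : MapsTo R.map Y Y) (hYm : MeasurableSet Y)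
    (hfY : MapsTo S.map (f ⁻¹' Y) (f ⁻¹' Y)) (hcpt : IsCompact (f ⁻¹' Y))
    (hinj : InjOn f (f ⁻¹' Y)) (hsurj : Function.Surjective f) :
    (S.restrict (f ⁻¹' Y) hfY).Iso (R.restrict Y hY) := by
  have hcs : CompactSpace (f ⁻¹' Y) := isCompact_iff_compactSpace.1 hcpt
  let g : f ⁻¹' Y → Y := Y.restrictPreimage f
  have hg : Continuous g := hf.restrictPreimage
  have hbij : Function.Bijective g :=
    ⟨fun x y hxy => Subtype.ext (hinj x.2 y.2 (congrArg Subtype.val hxy)),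
      restrictPreimage_surjective _ hsurj⟩
  let e : f ⁻¹' Y ≃ₜ Y :=
    Continuous.homeoOfEquivCompactToT2 (f := Equiv.ofBijective g hbij) hg
  have : BorelSpace (S.restrict (f ⁻¹' Y) hfY).carrier := Subtype.borelSpace _
  have : BorelSpace (R.restrict Y hY).carrier := Subtype.borelSpace _
  refine Iso.of_homeomorph (S := S.restrict (f ⁻¹' Y) hfY) (R := R.restrict Y hY) e ⟨?_, ?_⟩ ?_
  · exact hg.measurable
  · ext s hs
    have h1 : MeasurableSet (Subtype.val '' s : Set R.carrier) :=
      (MeasurableEmbedding.subtype_coe hYm).measurableSet_image.2 hs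
    refine (Measure.map_apply hg.measurable hs).trans ?_
    refine ((MeasurableEmbedding.subtype_coe (hpres.measurable hYm)).comap_apply _ _).trans ?_
    refine Eq.trans ?_ ((MeasurableEmbedding.subtype_coe hYm).comap_apply _ _).symm
    rw [← hpres.measure_preimage h1.nullMeasurableSet]
    congr 1
    ext x
    constructor
    · rintro ⟨y, hy, rfl⟩
      exact ⟨g y, hy, rfl⟩
    · rintro ⟨y, hy, hyx⟩
      have hx : f x ∈ Y := hyx ▸ y.2
      refine ⟨⟨x, hx⟩, ?_, rfl⟩
      have : g ⟨x, hx⟩ = y := Subtype.ext hyx.symm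
      exact mem_preimage.2 (this ▸ hy)
  · exact fun x => Subtype.ext (hmap x.1)

end DynSystem

/-! ### Restriction of a Markov shift to a class of states -/

namespace ShiftSpace

variable {H : Type u} (A : Matrix H H ℝ) (P : Set H)

/-- The sequences all of whose entries lie in the class `P`. -/
def within : Set (ShiftSpace A) := {s | ∀ n, s.seq n ∈ P}

variable {A P}

theorem mapsTo_within : MapsTo (shift A) (within A P) (within A P) := fun _ hs n => hs (n + 1)

theorem within_eq (hP : ∀ i ∈ P, ∀ j, A i j ≠ 0 → j ∈ P) : within A P = {s | s.seq 0 ∈ P} := by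
  refine Subset.antisymm (fun s hs => hs 0) fun s hs n => ?_
  induction n with
  | zero => exact hs
  | succ n ih => exact hP _ ih _ (s.2 n)

theorem isClopen_within (hP : ∀ i ∈ P, ∀ j, A i j ≠ 0 → j ∈ P) : IsClopen (within A P) := by
  rw [within_eq hP]
  exact ⟨⟨isLocallyConstant_seq 0 Pᶜ⟩, isLocallyConstant_seq 0 P⟩

variable (A P) in
/-- Sequences with entries in `P` as points of the shift space of the block `A|_{P × P}`. -/
def withinHomeomorph : within A P ≃ₜ ShiftSpace (A.block P) where
  toFun s := ⟨fun n => ⟨s.1.seq n, s.2 n⟩, fun n => s.1.2 n⟩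
  invFun s := ⟨⟨fun n => (s.seq n).1, fun n => s.2 n⟩, fun n => (s.seq n).2⟩
  continuous_toFun := by
    refine continuous_of_isLocallyConstant fun n => IsLocallyConstant.iff_isOpen_fiber.2 fun i => ?_
    have h := ((isLocallyConstant_seq (A := A) n).isOpen_fiber i.1).preimage
      (continuous_subtype_val : Continuous (Subtype.val : within A P → _))
    convert h using 1
    ext s
    exact Subtype.ext_iff
  continuous_invFun := by
    refine Continuous.subtype_mk (continuous_of_isLocallyConstant fun n => ?_) _
    exact (isLocallyConstant_seq (A := A.block P) n).comp Subtype.val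

end ShiftSpace

open ShiftSpace in
/-- The restriction of a Markov shift to a class of states without exit is the Markov shift of the
corresponding block. -/
theorem markovShift_restrict_iso {H : Type u} [Fintype H] {A : Matrix H H ℝ} {v : H → ℝ}
    (hA : IsStochastic A) (hv : ∀ i, 0 ≤ v i) {P : Set H} [Fintype P]
    (hP : ∀ i ∈ P, ∀ j, A i j ≠ 0 → j ∈ P) (hB : IsStochastic (A.block P)) :
    ((markovShift A v).restrict (within A P) mapsTo_within).Iso
      (markovShift (A.block P) fun i => v i) := by
  have hY : MeasurableSet (within A P) := (isClopen_within hP).isOpen.measurableSet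
  have : BorelSpace ((markovShift A v).restrict (within A P) mapsTo_within).carrier :=
    Subtype.borelSpace (α := ShiftSpace A) _
  have : BorelSpace (markovShift (A.block P) fun i => v i).carrier :=
    ShiftSpace.instBorelSpace (A := A.block P)
  have he : Measurable (withinHomeomorph A P) := (withinHomeomorph A P).continuous.measurable
  refine DynSystem.Iso.of_homeomorph (S := (markovShift A v).restrict (within A P) mapsTo_within)
    (R := markovShift (A.block P) fun i => v i) (withinHomeomorph A P) ⟨he, ?_⟩ fun _ => rfl
  refine IsMarkovMeasure.unique (A := A.block P) (v := fun i => v i) (fun ℓ d => ?_)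
    (isMarkovMeasure_markovMeasure hB fun i => hv i)
  refine (Measure.map_apply he (measurableSet_cyl d)).trans ?_
  refine ((MeasurableEmbedding.subtype_coe hY).comap_apply _ _).trans ?_
  refine Eq.trans ?_ (isMarkovMeasure_markovMeasure hA hv ℓ fun n => (d n).1)
  congr 1
  ext s
  constructor
  · rintro ⟨t, ht, rfl⟩ n
    exact congrArg Subtype.val (ht n)
  · intro hs
    have hmem : s ∈ within A P := by
      rw [within_eq hP]
      have h0 : s.seq 0 = (d 0).1 := hs 0
      exact h0.symm.subst (motive := (· ∈ P)) (d 0).2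
    exact ⟨⟨s, hmem⟩, fun n => Subtype.ext (hs n), rfl⟩

/-! ### Balls in a non-archimedean local field -/

/-- An isometry of a compact space into itself is surjective: the orbit of a point outside the
image would be uniformly separated. -/
theorem Isometry.surjective_of_compactSpace {M : Type*} [MetricSpace M] [CompactSpace M]
    {f : M → M} (hf : Isometry f) : Function.Surjective f := by
  intro y
  by_contra hy
  have hopen : IsOpen (range f)ᶜ := (isCompact_range hf.continuous).isClosed.isOpen_compl
  obtain ⟨ε, hε, hball⟩ := Metric.isOpen_iff.1 hopen y hy
  have hit : ∀ m, Isometry f^[m] := fun m => by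
    induction m with
    | zero => exact isometry_id
    | succ m ih => exact ih.comp hf
  have hsep : ∀ m k, ε ≤ dist (f^[m + (k + 1)] y) (f^[m] y) := by
    intro m k
    rw [Function.iterate_add_apply, (hit m).dist_eq, Function.iterate_succ_apply']
    by_contra! hlt
    exact hball hlt ⟨_, rfl⟩
  obtain ⟨a, φ, hφ, ha⟩ := CompactSpace.tendsto_subseq fun n => f^[n] y
  obtain ⟨N, hN⟩ := Metric.cauchySeq_iff'.1 ha.cauchySeq ε hε
  obtain ⟨k, hk⟩ := Nat.exists_eq_add_of_lt (hφ (Nat.lt_succ_self N))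
  refine (hsep (φ N) k).not_gt ?_
  have h := hN (N + 1) (Nat.le_succ N)
  rw [add_assoc] at hk
  simpa only [Function.comp_apply, ← hk] using h

section Haar

variable {K : Type u} [NontriviallyNormedField K] [IsUltrametricDist K]
  [MeasurableSpace K] [BorelSpace K] {μ : Measure K} [μ.IsAddHaarMeasure]

open scoped Pointwise in
/-- The measure of a ball about `0` is multiplicative in the radius. -/
theorem measureReal_closedBall_norm_mul [LocallyCompactSpace K]
    (hμ : μ (Metric.closedBall 0 1) = 1) {a : K} (ha : a ≠ 0)
    (b : K) : μ.real (Metric.closedBall 0 (‖a‖ * ‖b‖)) =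
      μ.real (Metric.closedBall 0 ‖a‖) * μ.real (Metric.closedBall 0 ‖b‖) := by
  have : ProperSpace K := ProperSpace.of_locallyCompactSpace K
  have hsmul : ∀ ρ, Units.mk0 a ha • Metric.closedBall (0 : K) ρ =
      Metric.closedBall 0 (‖a‖ * ρ) := by
    intro ρ
    ext x
    rw [Set.mem_smul_set_iff_inv_smul_mem]
    simp only [mem_closedBall_zero_iff, Units.smul_def, Units.val_inv_eq_inv_val, Units.val_mk0,
      smul_eq_mul, norm_mul, norm_inv]
    exact inv_mul_le_iff₀ (norm_pos_iff.2 ha)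
  have h1 := distribHaarChar_mul μ (Units.mk0 a ha) (Metric.closedBall 0 1)
  have h2 := distribHaarChar_mul μ (Units.mk0 a ha) (Metric.closedBall 0 ‖b‖)
  rw [hsmul, hμ, mul_one, mul_one] at h1
  rw [hsmul, h1] at h2
  simp only [Measure.real, ← h2, ENNReal.toReal_mul]

theorem measureReal_closedBall_lt_one (hμ : μ (Metric.closedBall 0 1) = 1) {ρ : ℝ} (hρ : ρ < 1) :
    μ.real (Metric.closedBall 0 ρ) < 1 := by
  have hopen : IsOpen (Metric.closedBall (0 : K) 1 \ Metric.closedBall 0 ρ) :=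
    (IsUltrametricDist.isOpen_closedBall 0 one_ne_zero).sdiff Metric.isClosed_closedBall
  have hpos := hopen.measure_pos μ ⟨1, by simp, by simpa using hρ⟩
  have hsub : Metric.closedBall (0 : K) ρ ⊆ Metric.closedBall 0 1 :=
    Metric.closedBall_subset_closedBall hρ.le
  have hlt : μ (Metric.closedBall 0 ρ) < 1 := by
    by_contra! hge
    rw [measure_sdiff hsub Metric.isClosed_closedBall.measurableSet.nullMeasurableSet
      ((measure_mono hsub).trans_lt (hμ.trans_lt ENNReal.one_lt_top)).ne, hμ,
      tsub_eq_zero_of_le hge] at hpos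
    exact lt_irrefl _ hpos
  simpa [Measure.real] using (ENNReal.toReal_lt_toReal hlt.ne_top ENNReal.one_ne_top).2 hlt

end Haar

/-! ### Locally scaling maps and their coding -/

theorem BallClass.toBall_rep {K : Type u} [NontriviallyNormedField K] {X : Set K} {r : ℝ}
    (i : BallClass X r) : toBall X r i.rep = i := Subtype.ext i.2.choose_spec

namespace IsLocallyScaling

section Ultrametric

variable {K : Type u} [NontriviallyNormedField K] {X : Set K} {r : ℝ} {T : X → X} {C : X → ℝ}

theorem scaling_eq_rep (h : IsLocallyScaling X r T C) (x : X) : C (toBall X r x).rep = C x :=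
  h.scaling_rep _ x (h.mem_toBall x)

theorem continuous (h : IsLocallyScaling X r T C) : Continuous T := by
  refine Metric.continuous_iff.2 fun x ε hε => ?_
  have hC : 0 < C x := zero_lt_one.trans_le (h.one_le x)
  refine ⟨min r (ε / C x), lt_min h.radius_pos (div_pos hε hC), fun y hy => ?_⟩
  rw [lt_min_iff, dist_comm, Subtype.dist_eq, dist_eq_norm] at hy
  rw [dist_comm, Subtype.dist_eq, dist_eq_norm, h.scaling x y hy.1.le, mul_comm]
  exact (lt_div_iff₀ hC).1 hy.2

/-- The scaling factors other than `1` are bounded away from `1`. -/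
theorem exists_one_lt_le [Finite (BallClass X r)] (h : IsLocallyScaling X r T C) :
    ∃ c > 1, ∀ x, C x ≠ 1 → c ≤ C x := by
  have hev : ∀ i : BallClass X r, ∀ᶠ c in 𝓝[>] (1 : ℝ), C i.rep ≠ 1 → c ≤ C i.rep := by
    intro i
    by_cases hi : C i.rep = 1
    · exact Filter.Eventually.of_forall fun c hc => absurd hi hc
    · filter_upwards [Ioo_mem_nhdsGT ((h.one_le i.rep).lt_of_ne' hi)] with c hc _
      exact hc.2.le
  obtain ⟨c, hc, h1⟩ := ((Filter.eventually_all.2 hev).and self_mem_nhdsWithin).exists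
  refine ⟨c, h1, fun x hx => ?_⟩
  rw [← h.scaling_eq_rep] at hx ⊢
  exact hc _ hx

variable [IsUltrametricDist K]

theorem norm_sub_le_trans {x y z : K} {ρ : ℝ} (h : ‖x - y‖ ≤ ρ) (h' : ‖y - z‖ ≤ ρ) :
    ‖x - z‖ ≤ ρ := by
  rw [← dist_eq_norm] at *
  exact (dist_triangle_max x y z).trans (max_le h h')

theorem mem_of_norm_sub_le (h : IsLocallyScaling X r T C) (x : X) {y : K} (hy : ‖y - x‖ ≤ r) :
    y ∈ X := by
  obtain ⟨F, hF⟩ := h.union_balls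
  obtain ⟨a, ha, hxa⟩ := mem_iUnion₂.1 (hF.le x.2)
  rw [mem_closedBall_iff_norm] at hxa
  exact hF.ge (mem_iUnion₂.2 ⟨a, ha, mem_closedBall_iff_norm.2 (norm_sub_le_trans hy hxa)⟩)

theorem toBall_eq_iff (h : IsLocallyScaling X r T C) {x y : X} :
    toBall X r x = toBall X r y ↔ ‖(x : K) - y‖ ≤ r := by
  constructor
  · intro hxy
    have hx := h.mem_toBall x
    rw [hxy] at hx
    exact hx
  · intro hxy
    refine Subtype.ext (Set.ext fun z => ⟨fun hz => norm_sub_le_trans hz hxy, fun hz => ?_⟩)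
    exact norm_sub_le_trans hz (by rwa [norm_sub_rev])

theorem mem_iff_toBall_eq (h : IsLocallyScaling X r T C) {i : BallClass X r} {x : X} :
    x ∈ i.1 ↔ toBall X r x = i := by
  obtain ⟨_, a, rfl⟩ := i
  exact h.toBall_eq_iff.symm

theorem isLocallyConstant_toBall (h : IsLocallyScaling X r T C) :
    IsLocallyConstant (toBall X r) := by
  refine (IsLocallyConstant.iff_eventually_eq _).2 fun x => ?_
  filter_upwards [Metric.closedBall_mem_nhds x h.radius_pos] with y hy
  rw [h.toBall_eq_iff, ← dist_eq_norm]
  exact hy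

theorem finite_ballClass (h : IsLocallyScaling X r T C) (hX : IsCompact X) :
    Finite (BallClass X r) := by
  have : CompactSpace X := isCompact_iff_compactSpace.1 hX
  have hfin := h.isLocallyConstant_toBall.range_finite
  have hsurj : Function.Surjective (toBall X r) := fun i => ⟨_, i.toBall_rep⟩
  rw [hsurj.range_eq] at hfin
  exact finite_univ_iff.1 hfin

/-- The scaling factors are absolute values of elements of the field. -/
theorem exists_norm_eq (h : IsLocallyScaling X r T C) (x : X) : ∃ c : K, c ≠ 0 ∧ ‖c‖ = C x := by
  obtain ⟨b, hb, hbr⟩ := h.radius_mem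
  have hy : (x : K) - b ∈ X := h.mem_of_norm_sub_le x (by simp [hbr])
  have hs := h.scaling x ⟨_, hy⟩ (by simp [hbr])
  rw [sub_sub_cancel] at hs
  have hC : C x ≠ 0 := (zero_lt_one.trans_le (h.one_le x)).ne'
  have hnorm : ‖((T x : K) - T ⟨_, hy⟩) / b‖ = C x := by
    rw [norm_div, hs, mul_div_cancel_right₀ _ (norm_ne_zero_iff.2 hb)]
  exact ⟨_, norm_ne_zero_iff.1 (hnorm ▸ hC), hnorm⟩

/-- A locally scaling map is onto the ball of radius `C x * r` about `T x`: after division by an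
element of absolute value `C x` it becomes an isometry of a compact ball into itself. -/
theorem exists_map_eq [LocallyCompactSpace K] (h : IsLocallyScaling X r T C) (x : X) {y : K}
    (hy : ‖y - T x‖ ≤ C x * r) : ∃ z : X, ‖(z : K) - x‖ ≤ r ∧ (T z : K) = y := by
  have : ProperSpace K := ProperSpace.of_locallyCompactSpace K
  obtain ⟨c, hc, hcx⟩ := h.exists_norm_eq x
  have hC : 0 < C x := zero_lt_one.trans_le (h.one_le x)
  have hmem : ∀ u : Metric.closedBall (0 : K) r, (x : K) + u ∈ X := fun u =>
    h.mem_of_norm_sub_le x (by simpa using mem_closedBall_zero_iff.1 u.2)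
  let g : Metric.closedBall (0 : K) r → X := fun u => ⟨_, hmem u⟩
  have hg : ∀ u, ‖(g u : K) - x‖ ≤ r := fun u => by
    simpa [g] using mem_closedBall_zero_iff.1 u.2
  have hTg : ∀ u w, ‖(T (g u) : K) - T (g w)‖ = C x * dist u w := by
    intro u w
    rw [h.scaling _ _ (norm_sub_le_trans (hg u) (by rw [norm_sub_rev]; exact hg w)),
      ← h.scaling_eq_rep, h.toBall_eq_iff.2 (hg u), h.scaling_eq_rep, Subtype.dist_eq,
      dist_eq_norm]
    simp [g]
  have hTx : ∀ u, ‖(T (g u) : K) - T x‖ = C x * ‖(u : K)‖ := by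
    intro u
    have h0 : g ⟨0, by simpa using h.radius_pos.le⟩ = x := Subtype.ext (by simp [g])
    have := hTg u ⟨0, by simpa using h.radius_pos.le⟩
    rwa [h0, Subtype.dist_eq, dist_zero_right] at this
  let f : Metric.closedBall (0 : K) r → Metric.closedBall (0 : K) r := fun u =>
    ⟨c⁻¹ * ((T (g u) : K) - T x), by
      rw [mem_closedBall_zero_iff, norm_mul, hTx, norm_inv, hcx, inv_mul_cancel_left₀ hC.ne']
      exact mem_closedBall_zero_iff.1 u.2⟩
  have hf : Isometry f := by
    refine Isometry.of_dist_eq fun u w => ?_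
    rw [Subtype.dist_eq, dist_eq_norm, ← mul_sub, sub_sub_sub_cancel_right, norm_mul, hTg,
      norm_inv, hcx, inv_mul_cancel_left₀ hC.ne']
  obtain ⟨u, hu⟩ := hf.surjective_of_compactSpace ⟨c⁻¹ * (y - T x), by
    rw [mem_closedBall_zero_iff, norm_mul, norm_inv, hcx]
    exact (inv_mul_le_iff₀ hC).2 hy⟩
  refine ⟨g u, hg u, ?_⟩
  exact sub_left_injective (mul_left_cancel₀ (inv_ne_zero hc) (congrArg Subtype.val hu))

end Ultrametric

end IsLocallyScaling

/-! ### The coding map -/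

namespace IsLocallyScaling

section Coding

variable {K : Type u} [NontriviallyNormedField K] [MeasurableSpace K] {μ : Measure K}
  {X : Set K} {r : ℝ} {T : X → X} {C : X → ℝ}

theorem transitionMatrix_nonneg (i j : BallClass X r) : 0 ≤ transitionMatrix μ r T C i j := by
  unfold transitionMatrix
  split_ifs
  · exact le_rfl
  · exact measureReal_nonneg

theorem transitionMatrix_eq {i j : BallClass X r} (hij : transitionMatrix μ r T C i j ≠ 0) :
    transitionMatrix μ r T C i j = μ.real (Metric.closedBall 0 (1 / C i.rep)) := by
  unfold transitionMatrix at hij ⊢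
  split_ifs at hij ⊢
  · exact absurd rfl hij
  · rfl

/-- A ball on which `T` is isometric has a single successor. -/
theorem eq_of_scaling_eq_one [Fintype (BallClass X r)]
    (hμ : μ (Metric.closedBall 0 1) = 1)
    (hA : IsStochastic (transitionMatrix μ r T C)) {i j j' : BallClass X r} (hi : C i.rep = 1)
    (hj : transitionMatrix μ r T C i j ≠ 0) (hj' : transitionMatrix μ r T C i j' ≠ 0) :
    j = j' := by
  have hone : ∀ {a}, transitionMatrix μ r T C i a ≠ 0 → transitionMatrix μ r T C i a = 1 := by
    intro a ha
    rw [transitionMatrix_eq ha, hi, div_one, Measure.real, hμ, ENNReal.toReal_one]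
  by_contra hne
  have hle : ∑ a ∈ {j, j'}, transitionMatrix μ r T C i a ≤ 1 := by
    rw [← hA.row_sum i]
    exact Finset.sum_le_sum_of_subset_of_nonneg (Finset.subset_univ _) fun a _ _ => hA.nonneg i a
  rw [Finset.sum_pair hne, hone hj, hone hj'] at hle
  norm_num at hle

/-- If the transition from `i` to the ball of `y` is allowed, then `T` maps the ball `i` onto a
set containing `y`. -/
theorem exists_map_eq_of_transition [IsUltrametricDist K] [LocallyCompactSpace K]
    (h : IsLocallyScaling X r T C) {i : BallClass X r} {y : X}
    (hij : transitionMatrix μ r T C i (toBall X r y) ≠ 0) : ∃ x, toBall X r x = i ∧ T x = y := by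
  unfold transitionMatrix at hij
  split_ifs at hij with hemp
  · exact absurd rfl hij
  obtain ⟨w, hwi, hwj⟩ := nonempty_iff_ne_empty.2 hemp
  have hw := h.toBall_eq_iff.1 (h.mem_iff_toBall_eq.1 hwj).symm
  obtain ⟨z, hz, hTz⟩ := h.exists_map_eq w (y := y)
    (hw.trans (le_mul_of_one_le_left h.radius_pos.le (h.one_le w)))
  exact ⟨z, (h.toBall_eq_iff.2 hz).trans (h.mem_iff_toBall_eq.1 hwi), Subtype.ext hTz⟩

variable [LocallyCompactSpace K] [μ.IsAddHaarMeasure]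

theorem coding_map (h : IsLocallyScaling X r T C) (x : X) :
    h.coding μ (T x) = ShiftSpace.shift _ (h.coding μ x) := rfl

theorem measureReal_closedBall_radius_pos (h : IsLocallyScaling X r T C) :
    0 < μ.real (Metric.closedBall 0 r) := by
  have : ProperSpace K := ProperSpace.of_locallyCompactSpace K
  exact ENNReal.toReal_pos (Metric.measure_closedBall_pos μ 0 h.radius_pos).ne'
    measure_closedBall_lt_top.ne

variable [IsUltrametricDist K]

/-- The coding map is injective on a piece with infinitely many itineraries: an itinerary in the
piece meets infinitely many balls on which `T` expands, by a factor bounded away from `1`, so two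
distinct points with the same itinerary would move arbitrarily far apart. -/
theorem injOn_coding [Fintype (BallClass X r)] (h : IsLocallyScaling X r T C)
    (hμ : μ (Metric.closedBall 0 1) = 1)
    (hA : IsStochastic (transitionMatrix μ r T C)) {P : Set (BallClass X r)}
    (hirr : ((transitionMatrix μ r T C).block P).IsIrreducible)
    [Infinite (ShiftSpace ((transitionMatrix μ r T C).block P))] :
    InjOn (h.coding μ) (h.piece μ P) := by
  intro x hx y _ hxy
  by_contra hne
  have hpos : 0 < ‖(x : K) - y‖ := norm_pos_iff.2 (sub_ne_zero.2 fun e => hne (Subtype.ext e))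
  have hle : ∀ n, ‖(T^[n] x : K) - T^[n] y‖ ≤ r := fun n =>
    h.toBall_eq_iff.1 (congrArg (fun s : ShiftSpace _ => s.seq n) hxy)
  have hstep : ∀ n, ‖(T^[n + 1] x : K) - T^[n + 1] y‖ =
      C (T^[n] x) * ‖(T^[n] x : K) - T^[n] y‖ := by
    intro n
    rw [Function.iterate_succ_apply', Function.iterate_succ_apply']
    exact h.scaling _ _ (hle n)
  have hmono : Monotone fun n => ‖(T^[n] x : K) - T^[n] y‖ := by
    refine monotone_nat_of_le_succ fun n => ?_
    rw [hstep]
    exact le_mul_of_one_le_left (norm_nonneg _) (h.one_le _)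
  have hexp : ∀ n, ∃ m ≥ n, C (T^[m] x) ≠ 1 := by
    intro n
    obtain ⟨m, hm, j, hj, hAj⟩ := ShiftSpace.exists_branching hirr
      (ShiftSpace.withinHomeomorph _ P ⟨h.coding μ x, hx⟩) n
    refine ⟨m, hm, fun hC => hj (Subtype.ext ?_)⟩
    rw [← h.scaling_eq_rep] at hC
    exact eq_of_scaling_eq_one hμ hA hC hAj ((h.coding μ x).2 m)
  obtain ⟨c, hc1, hc⟩ := h.exists_one_lt_le
  have hgrow : ∀ N : ℕ, ∃ n, c ^ N * ‖(x : K) - y‖ ≤ ‖(T^[n] x : K) - T^[n] y‖ := by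
    intro N
    induction N with
    | zero => exact ⟨0, by simp⟩
    | succ N ih =>
      obtain ⟨n, hn⟩ := ih
      obtain ⟨m, hm, hCm⟩ := hexp n
      refine ⟨m + 1, ?_⟩
      rw [hstep, pow_succ', mul_assoc]
      exact mul_le_mul (hc _ hCm) (hn.trans (hmono hm)) (by positivity)
        (zero_le_one.trans (h.one_le _))
  obtain ⟨N, hN⟩ := pow_unbounded_of_one_lt (r / ‖(x : K) - y‖) hc1
  obtain ⟨n, hn⟩ := hgrow N
  exact ((div_lt_iff₀ hpos).1 hN).not_ge (hn.trans (hle n))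

theorem continuous_coding (h : IsLocallyScaling X r T C) : Continuous (h.coding μ) :=
  ShiftSpace.continuous_of_isLocallyConstant fun n =>
    h.isLocallyConstant_toBall.comp_continuous (h.continuous.iterate n)

variable [BorelSpace K]

/-- The points with a given allowed initial itinerary form a ball, whose measure is the one that
the Markov measure assigns to the corresponding cylinder set. Prepending one ball to the itinerary
divides the radius by the scaling factor of that ball. -/
theorem preimage_cyl_eq (h : IsLocallyScaling X r T C) (hμ : μ (Metric.closedBall 0 1) = 1) {ℓ : ℕ}
    (d : Fin (ℓ + 1) → BallClass X r)
    (hd : ∏ n : Fin ℓ, transitionMatrix μ r T C (d n.castSucc) (d n.succ) ≠ 0) :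
    ∃ (x : X) (c : K), c ≠ 0 ∧ ‖c‖ ≤ r ∧
      h.coding μ ⁻¹' ShiftSpace.cyl _ d = {z : X | ‖(z : K) - x‖ ≤ ‖c‖} ∧
      μ.real (Metric.closedBall 0 ‖c‖) = μ.real (Metric.closedBall 0 r) *
        ∏ n : Fin ℓ, transitionMatrix μ r T C (d n.castSucc) (d n.succ) := by
  induction ℓ with
  | zero =>
    obtain ⟨i, rfl⟩ : ∃ i, d = fun _ => i := ⟨d 0, funext fun n => by rw [Fin.fin_one_eq_zero n]⟩
    obtain ⟨c, hc, hcr⟩ := h.radius_mem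
    refine ⟨i.rep, c, hc, hcr.le, ?_, by simp [hcr]⟩
    rw [ShiftSpace.cyl_const, hcr]
    ext z
    rw [mem_ofPred_eq, ← h.toBall_eq_iff, i.toBall_rep]
    rfl
  | succ ℓ ih =>
    obtain ⟨i, d, rfl⟩ : ∃ i d', d = Fin.cons i d' := ⟨_, _, (Fin.cons_self_tail d).symm⟩
    rw [ShiftSpace.prod_cons] at hd ⊢
    obtain ⟨y, c, hc, hcr, hset, hmeas⟩ := ih d (right_ne_zero_of_mul hd)
    have hy : toBall X r y = d 0 := by
      have hy' : y ∈ h.coding μ ⁻¹' ShiftSpace.cyl _ d := by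
        rw [hset]
        simp
      exact hy' 0
    have hi := left_ne_zero_of_mul hd
    obtain ⟨x, rfl, rfl⟩ := h.exists_map_eq_of_transition (hy.symm ▸ hi)
    obtain ⟨e, he, heC⟩ := h.exists_norm_eq x
    have hC : 0 < C x := zero_lt_one.trans_le (h.one_le x)
    have hnorm : ‖c * e⁻¹‖ = ‖c‖ / C x := by rw [norm_mul, norm_inv, heC, div_eq_mul_inv]
    have hle : ‖c‖ / C x ≤ r := (div_le_self (norm_nonneg c) (h.one_le x)).trans hcr
    refine ⟨x, c * e⁻¹, mul_ne_zero hc (inv_ne_zero he), hnorm ▸ hle, ?_, ?_⟩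
    · rw [ShiftSpace.cyl_cons, hnorm]
      ext z
      have hz : ‖(z : K) - x‖ ≤ r → (‖(T z : K) - T x‖ ≤ ‖c‖ ↔ ‖(z : K) - x‖ ≤ ‖c‖ / C x) := by
        intro hzr
        rw [h.scaling z x hzr, ← h.scaling_eq_rep z, h.toBall_eq_iff.2 hzr, h.scaling_eq_rep,
          le_div_iff₀' hC]
      have hT : T z ∈ h.coding μ ⁻¹' ShiftSpace.cyl _ d ↔ ‖(T z : K) - T x‖ ≤ ‖c‖ := by
        rw [hset]
        rfl
      constructor
      · rintro ⟨h0, h1⟩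
        exact (hz (h.toBall_eq_iff.1 h0)).1 (hT.1 h1)
      · intro hzc
        have hzr := le_trans hzc hle
        exact ⟨h.toBall_eq_iff.2 hzr, hT.2 ((hz hzr).2 hzc)⟩
    · rw [norm_mul, measureReal_closedBall_norm_mul hμ hc, hmeas, transitionMatrix_eq hi,
        h.scaling_eq_rep, norm_inv, heC, one_div]
      ring

/-- The measure on `X` of a ball of radius at most `r`. -/
theorem measure_closedBall (h : IsLocallyScaling X r T C) (hX : IsOpen X) (x : X) {ρ : ℝ}
    (hρ : ρ ≤ r) : μ.comap Subtype.val {z : X | ‖(z : K) - x‖ ≤ ρ} =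
      ENNReal.ofReal (μ.real (Metric.closedBall 0 ρ)) := by
  have : ProperSpace K := ProperSpace.of_locallyCompactSpace K
  rw [(MeasurableEmbedding.subtype_coe hX.measurableSet).comap_apply,
    ofReal_measureReal measure_closedBall_lt_top.ne,
    ← measure_preimage_add_right μ (-(x : K)) (Metric.closedBall 0 ρ)]
  congr 1
  ext z
  simp only [mem_image, mem_ofPred_eq, mem_preimage, mem_closedBall_zero_iff, ← sub_eq_add_neg]
  constructor
  · rintro ⟨w, hw, rfl⟩
    exact hw
  · exact fun hz => ⟨⟨z, h.mem_of_norm_sub_le x (hz.trans hρ)⟩, hz, rfl⟩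

/-- The image of the measure of `X` under the coding map has the values of the Markov measure on
cylinder sets. -/
theorem isMarkovMeasure_map_coding (h : IsLocallyScaling X r T C) (hX : IsOpen X)
    (hXc : IsCompact X) (hμ : μ (Metric.closedBall 0 1) = 1) :
    IsMarkovMeasure (transitionMatrix μ r T C) (ballVector μ r)
      ((μ.comap Subtype.val).map (h.coding μ)) := by
  have := h.finite_ballClass hXc
  intro ℓ d
  rw [Measure.map_apply h.continuous_coding.measurable (ShiftSpace.measurableSet_cyl d)]
  by_cases hd : ∏ n : Fin ℓ, transitionMatrix μ r T C (d n.castSucc) (d n.succ) = 0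
  · have hemp : ShiftSpace.cyl (transitionMatrix μ r T C) d = ∅ := by
      refine eq_empty_of_forall_notMem fun s hs => ?_
      obtain ⟨n, -, hn⟩ := Finset.prod_eq_zero_iff.1 hd
      rw [← hs n.castSucc, ← hs n.succ] at hn
      exact s.2 n hn
    rw [hd, hemp]
    simp
  · obtain ⟨x, c, -, hcr, hset, hmeas⟩ := h.preimage_cyl_eq hμ d hd
    rw [hset, h.measure_closedBall hX x hcr, hmeas]
    rfl

/-- Every admissible sequence of balls is an itinerary: the points following a finite initial part
of it form a decreasing sequence of non-empty compact sets. -/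
theorem surjective_coding (h : IsLocallyScaling X r T C) (hXc : IsCompact X)
    (hμ : μ (Metric.closedBall 0 1) = 1) : Function.Surjective (h.coding μ) := by
  have : CompactSpace X := isCompact_iff_compactSpace.1 hXc
  intro s
  let D : ℕ → Set X := fun N =>
    h.coding μ ⁻¹' ShiftSpace.cyl _ fun n : Fin (N + 1) => s.seq n
  have hclosed : ∀ N, IsClosed (D N) := by
    intro N
    refine IsClosed.preimage h.continuous_coding ?_
    rw [ShiftSpace.cyl, Set.ofPred_forall]
    exact isClosed_iInter fun n => (ShiftSpace.isLocallyConstant_seq _).isClosed_fiber _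
  have hne : ∀ N, (D N).Nonempty := by
    intro N
    obtain ⟨x, c, -, -, hset, -⟩ := h.preimage_cyl_eq hμ (fun n : Fin (N + 1) => s.seq n)
      (Finset.prod_ne_zero_iff.2 fun n _ => s.2 n)
    refine ⟨x, hset.ge ?_⟩
    simp
  have hmono : ∀ N, D (N + 1) ⊆ D N := fun N x hx n => hx n.castSucc
  obtain ⟨x, hx⟩ := IsCompact.nonempty_iInter_of_sequence_nonempty_isCompact_isClosed D hmono hne
    (hclosed 0).isCompact hclosed
  exact ⟨x, ShiftSpace.ext fun n => mem_iInter.1 hx n (Fin.last n)⟩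

/-- On a piece with finitely many itineraries all scaling factors are `1`. -/
theorem scaling_eq_one_of_finite (h : IsLocallyScaling X r T C)
    (hμ : μ (Metric.closedBall 0 1) = 1) {P : Set (BallClass X r)} [Fintype P]
    (hB : IsStochastic ((transitionMatrix μ r T C).block P))
    (hc : ∀ j, ∑ i, (transitionMatrix μ r T C).block P i j = 1)
    [Finite (ShiftSpace ((transitionMatrix μ r T C).block P))] {x : X}
    (hx : x ∈ h.piece μ P) : C x = 1 := by
  have hne := (h.coding μ x).2 0
  have hone : transitionMatrix μ r T C (toBall X r x) (toBall X r (T x)) = 1 :=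
    ShiftSpace.eq_one_of_finite hB hc (i := ⟨_, hx 0⟩) (j := ⟨_, hx 1⟩) hne
  have hval := (transitionMatrix_eq hne).symm.trans hone
  by_contra hC
  have hlt : 1 < C x := (h.one_le x).lt_of_ne' hC
  refine (measureReal_closedBall_lt_one hμ ((div_lt_one (zero_lt_one.trans hlt)).2 hlt)).ne ?_
  rw [← h.scaling_eq_rep x]
  exact hval

variable [Fintype (BallClass X r)]

theorem isStochastic_transitionMatrix (h : IsLocallyScaling X r T C) (hX : IsOpen X)
    (hXc : IsCompact X) (hμ : μ (Metric.closedBall 0 1) = 1) :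
    IsStochastic (transitionMatrix μ r T C) :=
  (h.isMarkovMeasure_map_coding hX hXc hμ).isStochastic transitionMatrix_nonneg
    fun _ => h.measureReal_closedBall_radius_pos

/-- The coding map carries the measure of `X` to the Markov measure. -/
theorem measurePreserving_coding (h : IsLocallyScaling X r T C) (hX : IsOpen X)
    (hXc : IsCompact X) (hμ : μ (Metric.closedBall 0 1) = 1) :
    MeasurePreserving (h.coding μ) (μ.comap Subtype.val)
      (markovMeasure (transitionMatrix μ r T C) (ballVector μ r)) :=
  ⟨h.continuous_coding.measurable, (h.isMarkovMeasure_map_coding hX hXc hμ).unique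
    (isMarkovMeasure_markovMeasure (h.isStochastic_transitionMatrix hX hXc hμ)
      fun _ => measureReal_nonneg)⟩

/-- The shift is a factor of `T` by means of the coding map, so it preserves the Markov measure. -/
theorem measurePreserving_shift (h : IsLocallyScaling X r T C) (hX : IsOpen X)
    (hXc : IsCompact X) (hμ : μ (Metric.closedBall 0 1) = 1)
    (hT : MeasurePreserving T (μ.comap Subtype.val) (μ.comap Subtype.val)) :
    MeasurePreserving (ShiftSpace.shift (transitionMatrix μ r T C))
      (markovMeasure (transitionMatrix μ r T C) (ballVector μ r))
      (markovMeasure (transitionMatrix μ r T C) (ballVector μ r)) :=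
  (h.measurePreserving_coding hX hXc hμ).of_semiconj hT (fun x => h.coding_map x)
    ShiftSpace.continuous_shift.measurable

/-- For a measure-preserving locally scaling map the transition matrix is doubly stochastic. -/
theorem col_sum_transitionMatrix (h : IsLocallyScaling X r T C) (hX : IsOpen X)
    (hXc : IsCompact X) (hμ : μ (Metric.closedBall 0 1) = 1)
    (hT : MeasurePreserving T (μ.comap Subtype.val) (μ.comap Subtype.val)) (j : BallClass X r) :
    ∑ i, transitionMatrix μ r T C i j = 1 := by
  have hA := h.isStochastic_transitionMatrix hX hXc hμ
  have hst := (isMarkovMeasure_markovMeasure hA fun _ => measureReal_nonneg).stationary hA.nonneg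
    (fun _ => measureReal_nonneg) (h.measurePreserving_shift hX hXc hμ hT) j
  rw [← Finset.mul_sum] at hst
  exact mul_left_cancel₀ h.measureReal_closedBall_radius_pos.ne' (hst.trans (mul_one _).symm)

end Coding

end IsLocallyScaling

/-! ### The decomposition -/

theorem mainTheorem1 {K : Type u} [NontriviallyNormedField K] [IsUltrametricDist K]
    [LocallyCompactSpace K] [MeasurableSpace K] [BorelSpace K]
    (μ : Measure K) [μ.IsAddHaarMeasure] (hμ : μ (Metric.closedBall 0 1) = 1)
    (X : Set K) (hXc : IsCompact X) (hXo : IsOpen X)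
    (r : ℝ) (T : X → X) (C : X → ℝ) (h : IsLocallyScaling X r T C)
    (hT : MeasurePreserving T (μ.comap Subtype.val) (μ.comap Subtype.val)) :
    -- the Markov shift attached to the transition matrix is measure-preserving
    MeasurePreserving (markovShift (transitionMatrix μ r T C) (ballVector μ r)).map
      (markovShift (transitionMatrix μ r T C) (ballVector μ r)).measure
      (markovShift (transitionMatrix μ r T C) (ballVector μ r)).measure ∧
    -- the index set splits into irreducible classes
    (∃ (n : ℕ) (P : Fin n → Set (BallClass X r)),
      IsIrreducibleDecomposition (transitionMatrix μ r T C) P) ∧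
    ∀ (n : ℕ) (P : Fin n → Set (BallClass X r)),
      IsIrreducibleDecomposition (transitionMatrix μ r T C) P →
      -- the Markov shift is the disjoint union of its blocks
      (markovShift (transitionMatrix μ r T C) (ballVector μ r)).Iso
        (DynSystem.disjointUnion fun k => h.blockShift μ (P k)) ∧
      -- the pieces form a partition of `X` into clopen completely invariant sets
      (∀ k, IsClopen (h.piece μ (P k)) ∧ T ⁻¹' h.piece μ (P k) = h.piece μ (P k)) ∧
      (Pairwise fun k l => Disjoint (h.piece μ (P k)) (h.piece μ (P l))) ∧
      ⋃ k, h.piece μ (P k) = univ ∧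
      -- the decomposition, globally and piece by piece
      (spaceSystem μ T).Iso (DynSystem.disjointUnion fun k => h.modelSystem μ (P k)) ∧
      (∀ k, (h.pieceSystem μ (P k)).Iso (h.modelSystem μ (P k))) ∧
      -- the two kinds of pieces
      (∀ k, Finite (ShiftSpace ((transitionMatrix μ r T C).block (P k))) →
        IsLocallyIsometric ((h.mapsTo_piece μ (P k)).restrict T _ _)) ∧
      (∀ k, Infinite (ShiftSpace ((transitionMatrix μ r T C).block (P k))) →
        (h.modelSystem μ (P k)).IsMarkov ∧
        Ergodic (h.modelSystem μ (P k)).map (h.modelSystem μ (P k)).measure) := by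
  have := h.finite_ballClass hXc
  let : Fintype (BallClass X r) := Fintype.ofFinite _
  have hXcs : CompactSpace X := isCompact_iff_compactSpace.1 hXc
  have hA := h.isStochastic_transitionMatrix hXo hXc hμ
  have hcol := h.col_sum_transitionMatrix hXo hXc hμ hT
  have hv : 0 < μ.real (Metric.closedBall 0 r) := h.measureReal_closedBall_radius_pos
  refine ⟨h.measurePreserving_shift hXo hXc hμ hT, hA.exists_isIrreducibleDecomposition hcol,
    fun n P hP => ?_⟩
  let : ∀ k, Fintype (P k) := fun k => Fintype.ofFinite _
  have hPc : ∀ k, ∀ i ∈ P k, ∀ j, transitionMatrix μ r T C i j ≠ 0 → j ∈ P k :=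
    fun k i hi j hij => (hP.mem_iff hij).1 hi
  have hB : ∀ k, IsStochastic ((transitionMatrix μ r T C).block (P k)) :=
    fun k => hP.isStochastic_block hA k
  have hwithin : ∀ k, IsClopen (ShiftSpace.within (transitionMatrix μ r T C) (P k)) := fun k =>
    ShiftSpace.isClopen_within (hPc k)
  have hshift : ∀ k, ((markovShift (transitionMatrix μ r T C) (ballVector μ r)).restrict _
      ShiftSpace.mapsTo_within).Iso (h.blockShift μ (P k)) := fun k =>
    markovShift_restrict_iso hA (fun _ => hv.le) (hPc k) (hB k)
  have hdisj : Pairwise fun k l => Disjoint (ShiftSpace.within (transitionMatrix μ r T C) (P k))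
      (ShiftSpace.within (transitionMatrix μ r T C) (P l)) := fun k l hkl =>
    Set.disjoint_left.2 fun s hs hs' => Set.disjoint_left.1 (hP.disjoint hkl) (hs 0) (hs' 0)
  have hcover : ⋃ k, ShiftSpace.within (transitionMatrix μ r T C) (P k) = univ := by
    refine eq_univ_of_forall fun s => ?_
    obtain ⟨k, hk⟩ := mem_iUnion.1 (hP.cover.ge (mem_univ (s.seq 0)))
    exact mem_iUnion.2 ⟨k, (ShiftSpace.within_eq (hPc k)).ge hk⟩
  have hclopen : ∀ k, IsClopen (h.piece μ (P k)) := fun k =>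
    (hwithin k).preimage h.continuous_coding
  have hpdisj : Pairwise fun k l => Disjoint (h.piece μ (P k)) (h.piece μ (P l)) := fun k l hkl =>
    (hdisj hkl).preimage (h.coding μ)
  have hpcover : ⋃ k, h.piece μ (P k) = univ := by
    have h' := congrArg (fun s => h.coding μ ⁻¹' s) hcover
    exact preimage_iUnion.symm.trans h'
  have : BorelSpace (spaceSystem μ T).carrier := Subtype.borelSpace X
  have : BorelSpace (markovShift (transitionMatrix μ r T C) (ballVector μ r)).carrier :=
    ShiftSpace.instBorelSpace
  have : T2Space (markovShift (transitionMatrix μ r T C) (ballVector μ r)).carrier :=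
    ShiftSpace.instT2Space
  have hpiece : ∀ k, (h.pieceSystem μ (P k)).Iso (h.modelSystem μ (P k)) := by
    intro k
    unfold IsLocallyScaling.modelSystem
    split_ifs with hfin
    · exact DynSystem.Iso.refl _
    · have : Infinite (ShiftSpace ((transitionMatrix μ r T C).block (P k))) :=
        not_finite_iff_infinite.1 hfin
      refine DynSystem.Iso.trans ?_ (hshift k)
      exact DynSystem.Iso.restrict_preimage (S := spaceSystem μ T)
        (R := markovShift (transitionMatrix μ r T C) (ballVector μ r)) (f := h.coding μ)
        h.continuous_coding (h.measurePreserving_coding hXo hXc hμ) (fun _ => rfl)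
        ShiftSpace.mapsTo_within (hwithin k).isOpen.measurableSet (h.mapsTo_piece μ (P k))
        (hclopen k).isClosed.isCompact (h.injOn_coding hμ hA (hP.irreducible k))
        (h.surjective_coding hXc hμ)
  refine ⟨?_, fun k => ⟨hclopen k, ?_⟩, hpdisj, hpcover, ?_, hpiece, fun k hfin => ?_,
    fun k hinf => ?_⟩
  · exact (DynSystem.iso_disjointUnion_restrict
      (markovShift (transitionMatrix μ r T C) (ballVector μ r))
      (fun k => ShiftSpace.mapsTo_within) (fun k => (hwithin k).isOpen) hdisj hcover).trans
      (DynSystem.Iso.disjointUnion hshift)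
  · refine Subset.antisymm (fun x hx => ?_) (h.mapsTo_piece μ (P k))
    refine (ShiftSpace.within_eq (hPc k)).ge ?_
    exact (hP.mem_iff ((h.coding μ x).2 0)).2 (hx 0)
  · exact (DynSystem.iso_disjointUnion_restrict (spaceSystem μ T)
      (fun k => h.mapsTo_piece μ (P k)) (fun k => (hclopen k).isOpen) hpdisj hpcover).trans
      (DynSystem.Iso.disjointUnion hpiece)
  · intro x
    refine ⟨Metric.closedBall x r, Metric.closedBall_mem_nhds x h.radius_pos,
      fun y hy z hz => ?_⟩
    have hyz : ‖(y.1 : K) - z.1‖ ≤ r := by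
      rw [Metric.mem_closedBall, Subtype.dist_eq, Subtype.dist_eq, dist_eq_norm] at hy hz
      exact IsLocallyScaling.norm_sub_le_trans hy (by rwa [norm_sub_rev])
    have hs := h.scaling y.1 z.1 hyz
    rw [h.scaling_eq_one_of_finite hμ (hB k) (hP.block_col_sum hcol k) y.2, one_mul] at hs
    rw [Subtype.dist_eq, Subtype.dist_eq, Subtype.dist_eq, Subtype.dist_eq, dist_eq_norm,
      dist_eq_norm]
    exact hs
  · have hmodel : h.modelSystem μ (P k) = h.blockShift μ (P k) :=
      if_neg (not_finite_iff_infinite.2 hinf)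
    rw [hmodel]
    have hν := isMarkovMeasure_markovMeasure (v := ballVector μ r) (hB k) fun _ => hv.le
    refine ⟨⟨P k, inferInstance, (hP.nonempty k).to_subtype, _, _, hB k, fun _ => hv.le,
      DynSystem.Iso.refl _⟩, ?_⟩
    have hpre := hν.preErgodic_shift (hB k) (hP.irreducible k) fun _ => hv
    have hinv := hν.measurePreserving_shift (hB k) (fun _ => hv.le) fun j =>
      (Finset.mul_sum _ _ _).symm.trans
        ((congrArg _ (hP.block_col_sum hcol k j)).trans (mul_one _))
    exact ⟨hinv, hpre⟩
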